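/- For $x>0$ let $C(x)=\exp\bigl(\sum_{n=1}^\infty \tfrac1n\Phi(-\sqrt n\,x)\bigr)$, where $\Phi$ is the standard normal distribution function. For each $k\ge 1$ consider $k$ alternatives $1,\dots,k$; the observations of alternative $i$ are normal with mean $\mu_i$ and variance $\sigma_i^2\ge 0$, and all observations are independent. The parameters $\mu_i,\sigma_i$ with $i\ge2$ may depend on $k$, while $\mu_1,\sigma_1$ do not. Let $\bar X_i(n)$ be the average of the first $n$ observations of alternative $i$. The greedy procedure with total budget $B$ takes one observation from every alternative, then repeatedly takes the next observation from an alternative whose current running average is largest until $B$ observations have been taken, and finally selects an alternative with the largest running average (ties are broken by an arbitrary fixed measurable function of the vector of running averages). $\mathrm{PCS}$ is the probability that alternative $1$ is selected. Assume that there are constants $\gamma>0$ and $\bar\sigma>0$ such that, for every $k$, $\mu_1-\mu_i\ge\gamma$ for all $2\le i\le k$ and $\sigma_i^2\le\bar\sigma^2$ for all $1\le i\le k$. Let $c>C(\gamma/\bar\sigma)$. Then there is a unique $\gamma_0\in(0,\gamma)$ with $C\bigl((\gamma-\gamma_0)/\bar\sigma\bigr)=c$, and, if the total budget is $B=ck$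 (rounded up or down to an integer), \[ \liminf_{k\to\infty}\mathrm{PCS}\;\ge\;\Pr\Bigl\{\min_{n\ge1}\bar X_1(n)>\mu_1-\gamma_0\Bigr\}=\Bigl[C\Bigl(\frac{\gamma_0}{\sigma_1}\Bigr)\Bigr]^{-1}>0, \] where the right-hand expression is read as $1$ if $\sigma_1=0$. In particular the greedy procedure is sample optimal: there is a constant $c>0$ such that $\liminf_{k\to\infty}\mathrm{PCS}>0$ for the budget $B=ck$ (rounded up or down to an integer). -/

import Mathlib

open MeasureTheory ProbabilityTheory Filter
open scoped NNReal Topology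

noncomputable section

namespace GreedyRS

/-- The cumulative distribution function of the standard normal distribution. -/
def Phi (x : ℝ) : ℝ := cdf (gaussianReal 0 1) x

/-- `C x = exp (∑_{n ≥ 1} Φ(-√n x) / n)`; the series converges for `x > 0`. -/
def C (x : ℝ) : ℝ :=
  Real.exp (∑' n : ℕ, Phi (-(Real.sqrt ((n : ℝ) + 1) * x)) / ((n : ℝ) + 1))

/-- The running average of the first `n` observations `x 0, …, x (n - 1)`. -/
def runningAverage (x : ℕ → ℝ) (n : ℕ) : ℝ := (∑ j ∈ Finset.range n, x j) / n

/-- A measurable way to pick an element of `argmax_i f i`, with an arbitrary tie-breaking. -/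
structure ArgmaxRule (ι : Type*) [MeasurableSpace ι] where
  pick : (ι → ℝ) → ι
  measurable_pick : Measurable pick
  le_pick : ∀ (f : ι → ℝ) (i : ι), f i ≤ f (pick f)

/-- The sample sizes of the alternatives after the initial observation of every alternative and
`t` further greedy observations; `x i j` is the `(j + 1)`-st observation of alternative `i`. -/
def greedySizes {ι : Type*} [DecidableEq ι] [MeasurableSpace ι] (r : ArgmaxRule ι)
    (x : ι → ℕ → ℝ) : ℕ → ι → ℕ
  | 0 => fun _ => 1
  | t + 1 =>
      let n := greedySizes r x t
      let s := r.pick fun i => runningAverage (x i) (n i)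
      Function.update n s (n s + 1)

/-- The alternative selected by the greedy procedure with total budget `B`: every alternative is
observed once, each of the remaining `B - k` observations goes to the alternative with the largest
running average, and the alternative with the largest running average is selected at the end. -/
def greedySelect {ι : Type*} [Fintype ι] [DecidableEq ι] [MeasurableSpace ι] (r : ArgmaxRule ι)
    (x : ι → ℕ → ℝ) (B : ℕ) : ι :=
  r.pick fun i => runningAverage (x i) (greedySizes r x (B - Fintype.card ι) i)

/-- All observations are independent, and the observations of alternative `i` are normal with
mean `μ i` and variance `(σ i) ^ 2`. -/
structure NormalObservations {Ω ι : Type*} [MeasurableSpace Ω] (P : Measure Ω)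
    (X : ι → ℕ → Ω → ℝ) (μ : ι → ℝ) (σ : ι → ℝ≥0) : Prop where
  measurable : ∀ i j, Measurable (X i j)
  law : ∀ i j, P.map (X i j) = gaussianReal (μ i) (σ i ^ 2)
  indep : iIndepFun (fun p : ι × ℕ => X p.1 p.2) P

/-- The probability of correct selection of the greedy procedure for `m + 1` alternatives, the best
of which is alternative `0`. -/
def PCS {Ω : Type*} [MeasurableSpace Ω] (P : Measure Ω) {m : ℕ} (r : ArgmaxRule (Fin (m + 1)))
    (X : Fin (m + 1) → ℕ → Ω → ℝ) (B : ℕ) : ℝ :=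
  P.real {ω | greedySelect r (fun i j => X i j ω) B = 0}

/-- The probability that the minimum over `n ≥ 1` of the running average of the first `n` terms of
`Y` is attained and exceeds `a`. -/
def probMinAbove {Ω : Type*} [MeasurableSpace Ω] (P : Measure Ω) (Y : ℕ → Ω → ℝ) (a : ℝ) : ℝ :=
  P.real {ω | ∃ y, IsLeast {z | ∃ n : ℕ, 1 ≤ n ∧ z = runningAverage (fun j => Y j ω) n} y ∧ a < y}

/-- `B m` is the budget `c k` for `k = m + 1` alternatives, rounded up or down to an integer. -/
def IsLinearBudget (c : ℝ) (B : ℕ → ℕ) : Prop :=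
  ∀ m : ℕ, |(B m : ℝ) - c * ((m : ℝ) + 1)| < 1

/-- Sample optimality of a fixed-budget procedure; `pcs m b` is its probability of correct
selection for `m + 1` alternatives and total budget `b`. -/
def SampleOptimal (pcs : ℕ → ℕ → ℝ) : Prop :=
  ∃ c : ℝ, 0 < c ∧ ∀ B : ℕ → ℕ, IsLinearBudget c B →
    0 < liminf (fun m => pcs m (B m)) atTop

end GreedyRS

end

noncomputable section

namespace GreedyRS

/-! ### Partial sums and future minima -/

/-! Fix a level `a = μ₁ - g` with `0 < g < γ₀` and suppose that all running averages of the best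
alternative exceed `a`. An inferior alternative whose running average has dropped to `a` or below is
then never observed again, so its sample size is at most the first passage time of its running
average to `(-∞, a]`, truncated at the budget (`stayCount`). These times are independent, with means
at most `C ((γ - g) / σbar)` and uniformly bounded second moments. By Chebyshev
(`measureReal_sum_stayCount_le`) their sum is, with probability tending to one, at most `m (C ((γ -
g) / σbar) + ε)`. Since `C ((γ - g) / σbar) < c`, the observations left for the best alternative
grow without bound. Once its sample has passed the last minimizer of its running averages, it leads
forever (`greedyPick_eq_of_lt`), hence it is selected (`greedySelect_eq`). The bound is the
probability that its running averages stay above `μ₁ - g`; finally `g` increases to `γ₀`.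

Both the mean passage times and this last probability come from the Sparre Andersen identity: for an
i.i.d. walk with `p n = P(S 1, …, S n > 0)`, one has `∑ p n s^n = exp (∑_{n ≥ 1} P(S n > 0) s^n /
n)`. At `s = 1` with negative drift it bounds the mean passage time (`SparreAndersen.sum_le_exp`);
with positive drift Abel's theorem gives `lim p n` (`SparreAndersen.tendsto_exp`). Normality turns
the exponents into the series defining `C`.

The identity is proved combinatorially. Let `g k` be the probability that `S k` is positive and
minimal among `S 1, …, S k`. Splitting at the last minimum gives `p n = ∑ g k p (n - k)`; splitting
`{S n > 0}` by cyclic rotations gives `P(S n > 0) = ∑ k g k p (n - k)`. Eliminating `g` between the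
generating functions leaves a linear differential equation. -/

/-- The partial sum of the first `n` terms of `x`. -/
def partialSum (x : ℕ → ℝ) (n : ℕ) : ℝ := ∑ j ∈ Finset.range n, x j

lemma partialSum_congr {x y : ℕ → ℝ} {n : ℕ} (h : ∀ i < n, x i = y i) :
    partialSum x n = partialSum y n :=
  Finset.sum_congr rfl fun i hi => h i (Finset.mem_range.1 hi)

lemma partialSum_shift (x : ℕ → ℝ) (a i : ℕ) :
    partialSum (fun l => x (a + l)) i = partialSum x (a + i) - partialSum x a := by
  simp [partialSum, Finset.sum_range_add]

lemma measurable_partialSum (n : ℕ) : Measurable fun x : ℕ → ℝ => partialSum x n := by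
  unfold partialSum; fun_prop

/-- The first `n` partial sums are positive. -/
def staysPositive (n : ℕ) : Set (ℕ → ℝ) := {x | ∀ j, 1 ≤ j → j ≤ n → 0 < partialSum x j}

/-- The `k`-th partial sum is positive and is a minimum of the partial sums `1, …, k`. -/
def minAt (k : ℕ) : Set (ℕ → ℝ) :=
  {x | 0 < partialSum x k ∧ ∀ j, 1 ≤ j → j < k → partialSum x k ≤ partialSum x j}

/-- The last minimum of the partial sums `1, …, n` is at `k`, and it is positive. -/
def lastMinAt (n k : ℕ) : Set (ℕ → ℝ) :=
  {x | x ∈ minAt k ∧ ∀ j, k < j → j ≤ n → partialSum x k < partialSum x j}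

lemma measurableSet_staysPositive (n : ℕ) : MeasurableSet (staysPositive n) := by
  simp only [staysPositive, Set.ofPred_forall]
  exact .iInter fun j => .iInter fun _ => .iInter fun _ =>
    measurableSet_lt measurable_const (measurable_partialSum j)

lemma measurableSet_minAt (k : ℕ) : MeasurableSet (minAt k) := by
  simp only [minAt, Set.ofPred_and, Set.ofPred_forall]
  exact (measurableSet_lt measurable_const (measurable_partialSum k)).inter <|
    .iInter fun j => .iInter fun _ => .iInter fun _ =>
      measurableSet_le (measurable_partialSum k) (measurable_partialSum j)

lemma measurableSet_lastMinAt (n k : ℕ) : MeasurableSet (lastMinAt n k) := by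
  simp only [lastMinAt, Set.ofPred_and, Set.ofPred_forall]
  exact (measurableSet_minAt k).inter <|
    .iInter fun j => .iInter fun _ => .iInter fun _ =>
      measurableSet_lt (measurable_partialSum k) (measurable_partialSum j)

lemma lastMinAt_disjoint {n k k' : ℕ} (hk : 1 ≤ k) (hk' : k' ≤ n) (h : k < k') :
    Disjoint (lastMinAt n k) (lastMinAt n k') := by
  rw [Set.disjoint_left]
  intro x hx hx'
  exact absurd (hx.2 k' h hk') (not_lt.2 (hx'.1.2 k hk h))

/-- A nonempty finite range of indices has a last minimizer. -/
lemma exists_last_min (T : ℕ → ℝ) (s : Finset ℕ) (hs : s.Nonempty) :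
    ∃ k ∈ s, (∀ j ∈ s, T k ≤ T j) ∧ ∀ j ∈ s, k < j → T k < T j := by
  obtain ⟨m, hm, hmin⟩ := s.exists_min_image T hs
  have hne : (s.filter fun j => T j ≤ T m).Nonempty := ⟨m, by simp [hm]⟩
  refine ⟨_, (Finset.mem_filter.1 (Finset.max'_mem _ hne)).1, fun j hj => ?_, fun j hj hlt => ?_⟩
  · exact (Finset.mem_filter.1 (Finset.max'_mem _ hne)).2.trans (hmin j hj)
  · by_contra hcon
    refine absurd (Finset.le_max' (s.filter fun j => T j ≤ T m) j ?_) (not_le.2 hlt)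
    exact Finset.mem_filter.2 ⟨hj, (not_lt.1 hcon).trans
      (Finset.mem_filter.1 (Finset.max'_mem _ hne)).2⟩

/-- The walk is positive up to `n` exactly when its minimum is. Ties are resolved in favour of the
last minimizer, which makes the pieces disjoint. -/
lemma staysPositive_eq_iUnion {n : ℕ} (hn : 1 ≤ n) :
    staysPositive n = ⋃ k ∈ Finset.Icc 1 n, lastMinAt n k := by
  ext x
  simp only [Set.mem_iUnion, exists_prop]
  constructor
  · intro hx
    obtain ⟨k, hk, hmin, hlast⟩ := exists_last_min (partialSum x) (Finset.Icc 1 n) ⟨1, by simp [hn]⟩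
    have hk' := Finset.mem_Icc.1 hk
    refine ⟨k, hk, ⟨hx k hk'.1 hk'.2, fun j h1 h2 => hmin j ?_⟩, fun j h1 h2 => hlast j ?_ h1⟩ <;>
      simp <;> omega
  · rintro ⟨k, hk, ⟨h0, h1⟩, h2⟩ j hj1 hj2
    rcases lt_trichotomy j k with h | h | h
    · exact h0.trans_le (h1 j hj1 h)
    · exact h ▸ h0
    · exact h0.trans (h2 j h hj2)

/-! ### Future minima of a periodic walk -/

/-- The indices at which `T` is smaller than at all later indices. -/
def futureMin (T : ℕ → ℝ) : Set ℕ := {m | ∀ i, m < i → T m < T i}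

/-- Each later period repeats the previous one, raised by `s > 0`, so one period of comparisons
suffices. -/
lemma mem_futureMin_of_window {T : ℕ → ℝ} {n m : ℕ} {s : ℝ} (hs : 0 < s)
    (hT : ∀ i, T (i + n) = T i + s) (hn : 1 ≤ n) (h : ∀ i, m < i → i ≤ m + n → T m < T i) :
    m ∈ futureMin T := by
  intro i
  induction i using Nat.strong_induction_on with
  | _ i ih =>
    intro hi
    rcases le_or_gt i (m + n) with h1 | h1
    · exact h i hi h1
    · have h2 := ih (i - n) (by omega) (by omega)
      have h3 := hT (i - n)
      rw [Nat.sub_add_cancel (by omega)] at h3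
      linarith

lemma exists_futureMin {T : ℕ → ℝ} {n : ℕ} {s : ℝ} (hs : 0 < s)
    (hT : ∀ i, T (i + n) = T i + s) (hn : 1 ≤ n) (a : ℕ) :
    ∃ m ∈ futureMin T, a ≤ m ∧ m < a + n := by
  obtain ⟨m, hm, hmin, hlast⟩ := exists_last_min T (Finset.Ico a (a + n)) ⟨a, by simp; omega⟩
  have hm' := Finset.mem_Ico.1 hm
  refine ⟨m, mem_futureMin_of_window hs hT hn fun i h1 h2 => ?_, hm'⟩
  rcases lt_or_ge i (a + n) with h | h
  · exact hlast i (Finset.mem_Ico.2 ⟨by omega, h⟩) h1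
  · have h3 := hT (i - n)
    rw [Nat.sub_add_cancel (by omega)] at h3
    have h4 := hmin (i - n) (Finset.mem_Ico.2 ⟨by omega, by omega⟩)
    linarith

lemma add_mem_futureMin {T : ℕ → ℝ} {n : ℕ} {s : ℝ}
    (hT : ∀ i, T (i + n) = T i + s) {m : ℕ} (hm : m ∈ futureMin T) :
    m + n ∈ futureMin T := by
  intro i hi
  have h3 := hT (i - n)
  rw [Nat.sub_add_cancel (by omega)] at h3
  have := hm (i - n) (by omega)
  have := hT m
  linarith

/-- `a` and `a + k` are consecutive future minima. -/
def consecutiveFutureMin (T : ℕ → ℝ) (a k : ℕ) : Prop :=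
  a ∈ futureMin T ∧ a + k ∈ futureMin T ∧ ∀ j, a < j → j < a + k → j ∉ futureMin T

/-- The right side says that the walk restarted at `a` has its last minimum over the steps `1, …, n`
at `k`, and that this minimum is positive. If some value strictly between `a` and `a + k` were below
`T (a + k)`, the last minimizer in between would be another future minimum. -/
lemma consecutiveFutureMin_iff {T : ℕ → ℝ} {n a k : ℕ} {s : ℝ} (hs : 0 < s)
    (hT : ∀ i, T (i + n) = T i + s) (hk : 1 ≤ k) (hkn : k ≤ n) :
    consecutiveFutureMin T a k ↔
      T a < T (a + k) ∧ (∀ j, 1 ≤ j → j < k → T (a + k) ≤ T (a + j)) ∧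
        ∀ j, k < j → j ≤ n → T (a + k) < T (a + j) := by
  constructor
  · rintro ⟨ha, hb, hbetween⟩
    refine ⟨ha _ (by omega), fun j h1 h2 => ?_, fun j h1 h2 => hb _ (by omega)⟩
    by_contra hcon
    obtain ⟨i, hi, hmin, hlast⟩ :=
      exists_last_min T (Finset.Ioo a (a + k)) ⟨a + j, by simp; omega⟩
    have hi' := Finset.mem_Ioo.1 hi
    have hib : T i < T (a + k) :=
      (hmin (a + j) (by simp; omega)).trans_lt (not_le.1 hcon)
    refine hbetween i hi'.1 hi'.2 fun l hl => ?_
    rcases lt_trichotomy l (a + k) with h | h | h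
    · exact hlast l (by simp; omega) hl
    · exact h ▸ hib
    · exact hib.trans (hb l h)
  · rintro ⟨h0, h1, h2⟩
    refine ⟨mem_futureMin_of_window hs hT (by omega) fun i hi1 hi2 => ?_,
      mem_futureMin_of_window hs hT (by omega) fun i hi1 hi2 => ?_, fun j hj1 hj2 hj => ?_⟩
    · obtain ⟨j, rfl⟩ := Nat.exists_eq_add_of_lt hi1
      rcases lt_trichotomy (j + 1) k with h | h | h
      · exact h0.trans_le (h1 (j + 1) (by omega) h)
      · rw [add_assoc, h]; exact h0
      · exact h0.trans (h2 (j + 1) h (by omega))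
    · rcases le_or_gt i (a + n) with h | h
      · have := h2 (i - a) (by omega) (by omega)
        rwa [Nat.add_sub_cancel' (by omega)] at this
      · have h3 := hT (i - n)
        rw [Nat.sub_add_cancel (by omega)] at h3
        -- Here `i - n` lies in `(a, a + k]`, where `T (a + k)` is minimal.
        have h4 : T (a + k) ≤ T (i - n) := by
          rcases Nat.lt_or_ge (i - n) (a + k) with h5 | h5
          · have := h1 (i - n - a) (by omega) (by omega)
            rwa [Nat.add_sub_cancel' (by omega)] at this
          · rw [show i - n = a + k by omega]
        linarith
    · have := h1 (j - a) (by omega) (by omega)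
      rw [Nat.add_sub_cancel' (by omega)] at this
      exact absurd (hj _ hj2) (not_lt.2 this)

lemma exists_consecutiveFutureMin {T : ℕ → ℝ} {n : ℕ} {s : ℝ} (hs : 0 < s)
    (hT : ∀ i, T (i + n) = T i + s) (hn : 1 ≤ n) :
    ∃ k j, 1 ≤ k ∧ k ≤ n ∧ j < k ∧ consecutiveFutureMin T (n - j) k := by
  classical
  -- Searching from `1` gives `m ≤ n < m + n`, hence future minima on both sides of the cut after
  -- `n`.
  obtain ⟨m, hm, hm1, hm2⟩ := exists_futureMin hs hT hn 1
  have hex : ∃ b, n < b ∧ b ∈ futureMin T := ⟨m + n, by omega, add_mem_futureMin hT hm⟩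
  let a := Nat.findGreatest (· ∈ futureMin T) n
  have ha : a ∈ futureMin T := Nat.findGreatest_spec (P := (· ∈ futureMin T)) (by omega) hm
  have han : a ≤ n := Nat.findGreatest_le n
  have ham : m ≤ a := Nat.le_findGreatest (by omega) hm
  obtain ⟨hb1, hb2⟩ := Nat.find_spec hex
  -- By periodicity `a + n` is also a future minimum beyond `n`, so the gap has length at most `n`.
  have hb3 : Nat.find hex ≤ a + n :=
    Nat.find_min' hex ⟨by omega, add_mem_futureMin hT ha⟩
  refine ⟨Nat.find hex - a, n - a, by omega, by omega, by omega, ?_⟩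
  rw [show n - (n - a) = a by omega]
  refine ⟨ha, by rwa [Nat.add_sub_cancel' (by omega)], fun j hj1 hj2 hj => ?_⟩
  rw [Nat.add_sub_cancel' (by omega)] at hj2
  rcases le_or_gt j n with h | h
  · exact absurd (Nat.le_findGreatest (P := (· ∈ futureMin T)) h hj) (not_le.2 hj1)
  · exact Nat.find_min hex hj2 ⟨h, hj⟩

/-- Both gaps satisfy `n - j ≤ n < n - j + k`, and distinct gaps between consecutive future minima
cannot both cover `n`. -/
lemma consecutiveFutureMin_unique {T : ℕ → ℝ} {n k j k' j' : ℕ} (hk : k ≤ n) (hk' : k' ≤ n)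
    (hj : j < k) (hj' : j' < k') (h : consecutiveFutureMin T (n - j) k)
    (h' : consecutiveFutureMin T (n - j') k') : k = k' ∧ j = j' := by
  have key : ∀ {k j k' j' : ℕ}, k ≤ n → k' ≤ n → j < k → j' < k' →
      consecutiveFutureMin T (n - j) k → consecutiveFutureMin T (n - j') k' →
        j' ≤ j ∧ n - j + k ≤ n - j' + k' := by
    intro k j k' j' hk hk' hj hj' h h'
    constructor
    · by_contra hcon
      exact h'.2.2 (n - j) (by omega) (by omega) h.1
    · by_contra hcon
      exact h.2.2 _ (by omega) (by omega) h'.2.1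
  have h1 := key hk hk' hj hj' h h'
  have h2 := key hk' hk hj' hj h' h
  omega

/-! ### Rotations of the first `n` terms of a sequence -/

/-- Rotate the indices `0, …, n - 1` by `n - j`. -/
def rotateIndex (n j i : ℕ) : ℕ := if i < n then (n - j + i) % n else i

lemma rotateIndex_injective {n j : ℕ} : Function.Injective (rotateIndex n j) := by
  intro a b hab
  unfold rotateIndex at hab
  have hlt : ∀ m, m < n → (n - j + m) % n < n := fun m hm => Nat.mod_lt _ (by omega)
  split_ifs at hab with h1 h2 h2
  · have h3 : n - j + a ≡ n - j + b [MOD n] := hab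
    have h4 := Nat.ModEq.add_left_cancel' _ h3
    rwa [Nat.ModEq, Nat.mod_eq_of_lt h1, Nat.mod_eq_of_lt h2] at h4
  · have := hlt a h1; omega
  · have := hlt b h2; omega
  · exact hab

/-- The rotation of the first `n` terms of `x` which starts at index `n - j`. -/
def rotate (n j : ℕ) (x : ℕ → ℝ) : ℕ → ℝ := fun i => x (rotateIndex n j i)

lemma measurable_rotate (n j : ℕ) : Measurable (rotate n j) := by
  unfold rotate; fun_prop

lemma partialSum_periodic (x : ℕ → ℝ) (n i : ℕ) :
    partialSum (fun l => x (l % n)) (i + n) = partialSum (fun l => x (l % n)) i + partialSum x n := by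
  have h := partialSum_shift (fun l => x (l % n)) n i
  simp only [Nat.add_mod_left] at h
  have h2 : partialSum (fun l => x (l % n)) n = partialSum x n :=
    partialSum_congr fun l hl => by rw [Nat.mod_eq_of_lt hl]
  rw [add_comm i n]
  linarith

lemma partialSum_rotate (x : ℕ → ℝ) {n j i : ℕ} (hi : i ≤ n) :
    partialSum (rotate n j x) i =
      partialSum (fun l => x (l % n)) (n - j + i) - partialSum (fun l => x (l % n)) (n - j) := by
  rw [← partialSum_shift]
  exact partialSum_congr fun l hl => by simp [rotate, rotateIndex, show l < n by omega]

/-- Partial sums of a rotation are increments of the periodic walk started at `n - j`, so the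
rotated event records a gap of length `k` starting there. -/
lemma rotate_mem_lastMinAt_iff {x : ℕ → ℝ} {n k j : ℕ} (hs : 0 < partialSum x n) (hk : 1 ≤ k)
    (hkn : k ≤ n) : rotate n j x ∈ lastMinAt n k ↔
      consecutiveFutureMin (partialSum fun l => x (l % n)) (n - j) k := by
  rw [consecutiveFutureMin_iff hs (partialSum_periodic x n) hk hkn]
  simp only [lastMinAt, minAt, Set.mem_ofPred_eq, and_assoc]
  rw [partialSum_rotate x hkn]
  refine and_congr sub_pos (and_congr ?_ ?_)
  · refine forall_congr' fun i => imp_congr_right fun h1 => imp_congr_right fun h2 => ?_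
    rw [partialSum_rotate x (by omega), sub_le_sub_iff_right]
  · refine forall_congr' fun i => imp_congr_right fun h1 => imp_congr_right fun h2 => ?_
    rw [partialSum_rotate x h2, sub_lt_sub_iff_right]

lemma partialSum_pos_of_rotate_mem {x : ℕ → ℝ} {n k j : ℕ} (hkn : k ≤ n)
    (h : rotate n j x ∈ lastMinAt n k) : 0 < partialSum x n := by
  have h1 : 0 < partialSum (rotate n j x) n := by
    rcases hkn.eq_or_lt with rfl | h'
    · exact h.1.1
    · exact h.1.1.trans (h.2 n h' le_rfl)
  rw [partialSum_rotate x le_rfl, partialSum_periodic] at h1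
  linarith

/-- `k` is the length of the gap covering `n` and `j` the distance from its left end to `n`. The `k`
choices of `j` produce the factor `k` in `iidLaw_partialSum_pos`. -/
lemma partialSum_pos_eq_iUnion {n : ℕ} (hn : 1 ≤ n) :
    {x : ℕ → ℝ | 0 < partialSum x n} =
      ⋃ p ∈ (Finset.Icc 1 n).sigma fun k => Finset.range k,
        rotate n p.2 ⁻¹' lastMinAt n p.1 := by
  ext x
  simp only [Set.mem_ofPred_eq, Set.mem_iUnion, Finset.mem_sigma, Finset.mem_Icc, Finset.mem_range,
    Set.mem_preimage, exists_prop]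
  constructor
  · intro hs
    obtain ⟨k, j, h1, h2, h3, h⟩ := exists_consecutiveFutureMin hs (partialSum_periodic x n) hn
    exact ⟨⟨k, j⟩, ⟨⟨h1, h2⟩, h3⟩, (rotate_mem_lastMinAt_iff hs h1 h2).2 h⟩
  · rintro ⟨⟨k, j⟩, ⟨⟨h1, h2⟩, h3⟩, h⟩
    exact partialSum_pos_of_rotate_mem h2 h

lemma pairwiseDisjoint_rotate (n : ℕ) :
    (((Finset.Icc 1 n).sigma fun k => Finset.range k : Finset (Σ _ : ℕ, ℕ)) :
      Set (Σ _ : ℕ, ℕ)).PairwiseDisjoint fun p => rotate n p.2 ⁻¹' lastMinAt n p.1 := by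
  rintro ⟨k, j⟩ hp ⟨k', j'⟩ hp' hne
  simp only [Finset.coe_sigma, Set.mem_sigma_iff, Finset.mem_coe, Finset.mem_Icc,
    Finset.mem_range] at hp hp'
  rw [Function.onFun, Set.disjoint_left]
  intro x hx hx'
  have hs := partialSum_pos_of_rotate_mem hp.1.2 hx
  obtain ⟨rfl, rfl⟩ := consecutiveFutureMin_unique hp.1.2 hp'.1.2 hp.2 hp'.2
    ((rotate_mem_lastMinAt_iff hs hp.1.1 hp.1.2).1 hx)
    ((rotate_mem_lastMinAt_iff hs hp'.1.1 hp'.1.2).1 hx')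
  exact hne rfl

/-! ### The Sparre Andersen recursion -/

/-- The law of a sequence of independent random variables with law `ν`. -/
abbrev iidLaw (ν : Measure ℝ) [IsProbabilityMeasure ν] : Measure (ℕ → ℝ) :=
  Measure.infinitePi fun _ => ν

variable (ν : Measure ℝ) [IsProbabilityMeasure ν]

lemma measurePreserving_reindex {f : ℕ → ℕ} (hf : Function.Injective f) :
    MeasurePreserving (fun (x : ℕ → ℝ) i => x (f i)) (iidLaw ν) (iidLaw ν) :=
  ⟨by fun_prop, Measure.map_infinitePi_infinitePi_of_inj (P := fun _ => ν) hf⟩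

/-- Extend a finite vector of terms by zeros. -/
def extendZero (s : Finset ℕ) (u : s → ℝ) (i : ℕ) : ℝ := if h : i ∈ s then u ⟨i, h⟩ else 0

lemma measurable_extendZero (s : Finset ℕ) : Measurable (extendZero s) := by
  refine measurable_pi_lambda _ fun i => ?_
  unfold extendZero
  split_ifs <;> fun_prop

lemma iidLaw_inter_shift {A B : Set (ℕ → ℝ)} (hA : MeasurableSet A) (hB : MeasurableSet B)
    {k l : ℕ} (hAk : ∀ x y : ℕ → ℝ, (∀ i < k, x i = y i) → (x ∈ A → y ∈ A))
    (hBl : ∀ x y : ℕ → ℝ, (∀ i < l, x i = y i) → (x ∈ B → y ∈ B)) :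
    (iidLaw ν).real (A ∩ (fun x i => x (k + i)) ⁻¹' B) = (iidLaw ν).real A * (iidLaw ν).real B := by
  have hind : iIndepFun (fun (i : ℕ) (x : ℕ → ℝ) => x i) (iidLaw ν) :=
    iIndepFun_infinitePi (P := fun _ : ℕ => ν) (X := fun _ x => x) fun _ => measurable_id
  have h := hind.indepFun_finset (Finset.range k) (Finset.Ico k (k + l))
    (by rw [Finset.disjoint_left]; intro i; simp; omega) (fun i => measurable_pi_apply i)
  -- Padding by zeros exhibits each event as a measurable preimage under a finite block of
  -- coordinates; the two blocks are disjoint, hence independent.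
  have e1 : A = (fun (x : ℕ → ℝ) (i : Finset.range k) => x i) ⁻¹'
      (extendZero (Finset.range k) ⁻¹' A) := by
    ext x
    constructor
    · exact hAk _ _ fun i hi => by simp [extendZero, hi]
    · exact hAk _ _ fun i hi => by simp [extendZero, hi]
  have e2 : (fun (x : ℕ → ℝ) i => x (k + i)) ⁻¹' B =
      (fun (x : ℕ → ℝ) (i : Finset.Ico k (k + l)) => x i) ⁻¹'
      ((fun (x : ℕ → ℝ) i => x (k + i)) ∘ extendZero (Finset.Ico k (k + l)) ⁻¹' B) := by
    ext x
    constructor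
    · exact hBl _ _ fun i hi => by simp [extendZero, hi]
    · exact hBl _ _ fun i hi => by simp [extendZero, hi]
  have hB' := (measurePreserving_reindex ν (add_right_injective k)).measureReal_preimage
    hB.nullMeasurableSet
  rw [← hB']
  have hm : Measurable fun (x : ℕ → ℝ) i => x (k + i) := by fun_prop
  have := h.measure_inter_preimage_eq_mul _ _ (measurable_extendZero _ hA)
    ((hm.comp (measurable_extendZero _)) hB)
  rw [← e1, ← e2] at this
  simp only [Measure.real, this, ENNReal.toReal_mul]

lemma iidLaw_lastMinAt {n k : ℕ} (hkn : k ≤ n) :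
    (iidLaw ν).real (lastMinAt n k) =
      (iidLaw ν).real (minAt k) * (iidLaw ν).real (staysPositive (n - k)) := by
  rw [← iidLaw_inter_shift ν (measurableSet_minAt k) (measurableSet_staysPositive (n - k))
    (k := k) (l := n - k)]
  · congr 1
    ext x
    refine and_congr_right fun _ => ⟨fun h j h1 h2 => ?_, fun h j h1 h2 => ?_⟩
    · rw [partialSum_shift, sub_pos]
      exact h _ (by omega) (by omega)
    · have := h (j - k) (by omega) (by omega)
      rwa [partialSum_shift, sub_pos, Nat.add_sub_cancel' h1.le] at this
  · intro x y hxy hx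
    have e : ∀ j ≤ k, partialSum x j = partialSum y j := fun j hj =>
      partialSum_congr fun i hi => hxy i (by omega)
    refine ⟨e k le_rfl ▸ hx.1, fun j h1 h2 => ?_⟩
    rw [← e k le_rfl, ← e j h2.le]
    exact hx.2 j h1 h2
  · intro x y hxy hx j h1 h2
    rw [← partialSum_congr fun i hi => hxy i (by omega)]
    exact hx j h1 h2

/-- Renewal equation for the probability that the first `n` partial sums are positive. -/
lemma iidLaw_staysPositive {n : ℕ} (hn : 1 ≤ n) :
    (iidLaw ν).real (staysPositive n) = ∑ k ∈ Finset.Icc 1 n,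
      (iidLaw ν).real (minAt k) * (iidLaw ν).real (staysPositive (n - k)) := by
  rw [staysPositive_eq_iUnion hn, measureReal_biUnion_finset]
  · exact Finset.sum_congr rfl fun k hk => iidLaw_lastMinAt ν (Finset.mem_Icc.1 hk).2
  · intro k hk k' hk' hne
    have h1 := Finset.mem_Icc.1 (Finset.mem_coe.1 hk)
    have h2 := Finset.mem_Icc.1 (Finset.mem_coe.1 hk')
    rcases lt_or_gt_of_ne hne with h | h
    · exact lastMinAt_disjoint h1.1 h2.2 h
    · exact (lastMinAt_disjoint h2.1 h1.2 h).symm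
  · exact fun k _ => measurableSet_lastMinAt n k

/-- Decomposition of `{0 < S n}` according to the gap between future minima which covers `n`. -/
lemma iidLaw_partialSum_pos {n : ℕ} (hn : 1 ≤ n) :
    (iidLaw ν).real {x | 0 < partialSum x n} = ∑ k ∈ Finset.Icc 1 n,
      k * ((iidLaw ν).real (minAt k) * (iidLaw ν).real (staysPositive (n - k))) := by
  rw [partialSum_pos_eq_iUnion hn, measureReal_biUnion_finset (pairwiseDisjoint_rotate n)
    fun p _ => measurable_rotate n p.2 (measurableSet_lastMinAt n p.1), Finset.sum_sigma]
  refine Finset.sum_congr rfl fun k hk => ?_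
  have h : ∀ j, (iidLaw ν).real (rotate n j ⁻¹' lastMinAt n k) = (iidLaw ν).real (lastMinAt n k) :=
    fun j => (measurePreserving_reindex ν rotateIndex_injective).measureReal_preimage
      (measurableSet_lastMinAt n k).nullMeasurableSet
  simp only [h, Finset.sum_const, Finset.card_range, nsmul_eq_mul]
  rw [iidLaw_lastMinAt ν (Finset.mem_Icc.1 hk).2]

section Recursion

variable (ν : Measure ℝ) [IsProbabilityMeasure ν]

/-- The Sparre Andersen recursion, which relates the probability that the first `n` partial sums
are positive to the probabilities that the individual partial sums are positive. -/
lemma sparreAndersen_recursion (n : ℕ) :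
    ((n : ℝ) + 1) * (iidLaw ν).real (staysPositive (n + 1)) =
      ∑ ij ∈ Finset.HasAntidiagonal.antidiagonal n, (iidLaw ν).real {x | 0 < partialSum x (ij.1 + 1)} *
        (iidLaw ν).real (staysPositive ij.2) := by
  let U : PowerSeries ℝ := PowerSeries.mk fun n => (iidLaw ν).real (staysPositive n)
  let G : PowerSeries ℝ := PowerSeries.mk fun n => (iidLaw ν).real (minAt n)
  let Q : PowerSeries ℝ := PowerSeries.mk fun n => (iidLaw ν).real {x | 0 < partialSum x (n + 1)}
  let D := PowerSeries.derivative ℝ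
  have hG0 : (iidLaw ν).real (minAt 0) = 0 := by
    have : minAt 0 = ∅ := by ext x; simp [minAt, partialSum]
    simp [this]
  have hU0 : (iidLaw ν).real (staysPositive 0) = 1 := by
    have : staysPositive 0 = Set.univ := by
      ext x
      simp only [staysPositive, Set.mem_ofPred_eq, Set.mem_univ, iff_true]
      intro j h1 h2; omega
    simp [this]
  have hsum : ∀ (f : ℕ → ℕ → ℝ) (m : ℕ), ∑ k ∈ Finset.Icc 1 (m + 1), f k (m + 1 - k) =
      ∑ ij ∈ Finset.HasAntidiagonal.antidiagonal m, f (ij.1 + 1) ij.2 := by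
    intro f m
    rw [Finset.Nat.sum_antidiagonal_eq_sum_range_succ_mk, Finset.range_eq_Ico]
    have h := Finset.sum_Ico_add' (fun k => f k (m + 1 - k)) 0 (m + 1) 1
    simp only [Nat.add_sub_add_right] at h
    exact h.symm
  have hII : U = 1 + G * U := by
    ext m
    rcases m with _ | m
    · simp [U, G, hG0, hU0]
    · rw [map_add, PowerSeries.coeff_mul, Finset.Nat.antidiagonal_succ, Finset.sum_cons]
      simp only [U, G, PowerSeries.coeff_mk, hG0, zero_mul, zero_add, PowerSeries.coeff_one,
        Nat.succ_ne_zero, if_false, Finset.sum_map]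
      rw [iidLaw_staysPositive ν (by omega),
        hsum (fun k l => (iidLaw ν).real (minAt k) * (iidLaw ν).real (staysPositive l))]
      rfl
  have hI : D G * U = Q := by
    ext m
    rw [PowerSeries.coeff_mul]
    simp only [U, G, Q, D, PowerSeries.coeff_mk, PowerSeries.coeff_derivative]
    rw [iidLaw_partialSum_pos ν (by omega),
      hsum (fun k l => k * ((iidLaw ν).real (minAt k) * (iidLaw ν).real (staysPositive l)))]
    exact Finset.sum_congr rfl fun ij _ => by push_cast; ring
  have hD : D U = D G * U + G * D U := by
    conv_lhs => rw [hII]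
    rw [map_add, Derivation.leibniz]
    simp [D, mul_comm, add_comm]
  -- Differentiating `U = 1 + G U` gives `(1 - G) U' = G' U = Q`, and `U` is the inverse of `1 - G`.
  have key : D U = Q * U := by
    have h1 : U * (1 - G) = 1 := by linear_combination hII
    linear_combination (-D U) * h1 + U * hD + U * hI
  have := congrArg (PowerSeries.coeff n) key
  rw [PowerSeries.coeff_mul] at this
  simp only [U, Q, D, PowerSeries.coeff_mk, PowerSeries.coeff_derivative] at this
  linarith

end Recursion

/-! ### Generating functions -/

lemma summable_mul_pow {a : ℕ → ℝ} (ha : ∀ n, |a n| ≤ 1) {s : ℝ} (hs : |s| < 1) :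
    Summable fun n => a n * s ^ n := by
  refine .of_norm_bounded (summable_geometric_of_lt_one (abs_nonneg s) hs) fun n => ?_
  rw [norm_mul, norm_pow, Real.norm_eq_abs, Real.norm_eq_abs]
  exact mul_le_of_le_one_left (by positivity) (ha n)

lemma hasDerivAt_tsum_mul_pow {a : ℕ → ℝ} (ha : ∀ n, |a n| ≤ 1) {s : ℝ} (hs : |s| < 1) :
    HasDerivAt (fun t : ℝ => ∑' n, a n * t ^ n) (∑' n : ℕ, ((n : ℝ) + 1) * a (n + 1) * s ^ n) s := by
  obtain ⟨r, hr1, hr2⟩ := exists_between hs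
  have hr0 : 0 ≤ r := (abs_nonneg s).trans hr1.le
  have hu : Summable fun n : ℕ => (n : ℝ) * r ^ (n - 1) := by
    refine (summable_nat_add_iff 1).1 ?_
    simp only [Nat.add_sub_cancel]
    have h1 := summable_pow_mul_geometric_of_norm_lt_one 1 (r := r) (by
      rwa [Real.norm_eq_abs, abs_of_nonneg hr0])
    have h2 := summable_geometric_of_lt_one hr0 hr2
    refine (h1.add h2).congr fun n => ?_
    push_cast; ring
  have hbound : ∀ n (y : ℝ), y ∈ Metric.ball (0 : ℝ) r →
      ‖a n * (n * y ^ (n - 1))‖ ≤ n * r ^ (n - 1) := by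
    intro n y hy
    have hy' : |y| ≤ r := by simpa using (Metric.mem_ball.1 hy).le
    rw [norm_mul, norm_mul, norm_pow, Real.norm_eq_abs, Real.norm_eq_abs, Real.norm_eq_abs,
      Nat.abs_cast]
    calc |a n| * (n * |y| ^ (n - 1)) ≤ 1 * (n * r ^ (n - 1)) := by
          gcongr; exact ha n
      _ = _ := one_mul _
  have hsb : s ∈ Metric.ball (0 : ℝ) r := by simpa using hr1
  have h := hasDerivAt_tsum_of_isPreconnected (g := fun n t => a n * t ^ n)
    (g' := fun n t => a n * (n * t ^ (n - 1))) hu Metric.isOpen_ball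
    (convex_ball (0 : ℝ) r).isPreconnected
    (fun n y _ => (hasDerivAt_pow n y).const_mul (a n)) hbound hsb (summable_mul_pow ha hs) hsb
  refine h.congr_deriv ?_
  rw [(Summable.of_norm_bounded hu fun n => hbound n s hsb).tsum_eq_zero_add]
  simp only [Nat.cast_zero, zero_mul, mul_zero, zero_add, Nat.add_sub_cancel, Nat.cast_add,
    Nat.cast_one]
  exact tsum_congr fun n => by ring

/-- A sequence `p` with values in `[0, 1]` which is determined from `q` by the
Sparre Andersen recursion. -/
structure SparreAndersen (p q : ℕ → ℝ) : Prop where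
  zero : p 0 = 1
  nonneg : ∀ n, 0 ≤ p n
  le_one : ∀ n, p n ≤ 1
  q_nonneg : ∀ n, 0 ≤ q n
  q_le_one : ∀ n, q n ≤ 1
  recursion : ∀ n : ℕ, ((n : ℝ) + 1) * p (n + 1) =
    ∑ ij ∈ Finset.HasAntidiagonal.antidiagonal n, q ij.1 * p ij.2

namespace SparreAndersen

variable {p q : ℕ → ℝ}

lemma abs_p_le (h : SparreAndersen p q) (n : ℕ) : |p n| ≤ 1 :=
  abs_le.2 ⟨by linarith [h.nonneg n], h.le_one n⟩

lemma abs_q_le (h : SparreAndersen p q) (n : ℕ) : |q n| ≤ 1 :=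
  abs_le.2 ⟨by linarith [h.q_nonneg n], h.q_le_one n⟩

/-- At `n = 0` the coefficient is a division by zero, hence `0`: the logarithmic series really
starts at `n = 1`. -/
lemma abs_log_coeff_le (h : SparreAndersen p q) (n : ℕ) : |q (n - 1) / n| ≤ 1 := by
  rw [abs_div, Nat.abs_cast]
  rcases n with _ | n
  · simp
  · exact div_le_one_of_le₀ ((h.abs_q_le _).trans (by simp)) (by positivity)

/-- The generating function of `p` is the exponential of the generating function of `q n / n`. -/
lemma tsum_eq_exp (h : SparreAndersen p q) {s : ℝ} (hs : |s| < 1) :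
    ∑' n, p n * s ^ n = Real.exp (∑' n : ℕ, q (n - 1) / n * s ^ n) := by
  let U : ℝ → ℝ := fun t => ∑' n, p n * t ^ n
  let L : ℝ → ℝ := fun t => ∑' n : ℕ, q (n - 1) / n * t ^ n
  have hU : ∀ t, |t| < 1 → HasDerivAt U ((∑' n, q n * t ^ n) * U t) t := by
    intro t ht
    refine (hasDerivAt_tsum_mul_pow h.abs_p_le ht).congr_deriv (Eq.symm ?_)
    simp only [U]
    rw [tsum_mul_tsum_eq_tsum_sum_antidiagonal_of_summable_norm
      (summable_mul_pow h.abs_q_le ht).norm (summable_mul_pow h.abs_p_le ht).norm]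
    refine tsum_congr fun n => ?_
    rw [h.recursion, Finset.sum_mul]
    refine Finset.sum_congr rfl fun ij hij => ?_
    rw [← Finset.HasAntidiagonal.mem_antidiagonal.1 hij, pow_add]
    ring
  have hL : ∀ t, |t| < 1 → HasDerivAt L (∑' n, q n * t ^ n) t := by
    intro t ht
    refine (hasDerivAt_tsum_mul_pow h.abs_log_coeff_le ht).congr_deriv ?_
    refine tsum_congr fun n => ?_
    simp only [Nat.add_sub_cancel]
    push_cast
    field_simp
  -- `U' = Q U` and `L' = Q`, so `U exp (-L)` is constant on the unit ball.
  have hF : ∀ t ∈ Metric.ball (0 : ℝ) 1,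
      HasDerivWithinAt (fun t => U t * Real.exp (-L t)) 0 (Metric.ball 0 1) t := by
    intro t ht
    have ht' : |t| < 1 := by simpa using ht
    refine (((hU t ht').mul ((hL t ht').neg.exp)).congr_deriv ?_).hasDerivWithinAt
    ring
  have hconst := (convex_ball (0 : ℝ) 1).is_const_of_fderivWithin_eq_zero (𝕜 := ℝ)
    (f := fun t => U t * Real.exp (-L t)) (fun t ht => (hF t ht).differentiableWithinAt)
    (fun t ht => by
      have := (hF t ht).hasFDerivWithinAt.fderivWithin
        (Metric.isOpen_ball.uniqueDiffWithinAt ht)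
      rw [this]; ext; simp) (x := s) (y := 0) (by simpa using hs) (by simp)
  have hU0 : U 0 = 1 := by
    simp only [U]
    rw [tsum_eq_single 0 fun n hn => by simp [hn]]
    simp [h.zero]
  have hL0 : L 0 = 0 := by
    simp only [L]
    rw [tsum_eq_single 0 fun n hn => by simp [hn]]
    simp
  simp only [hU0, hL0, neg_zero, Real.exp_zero, mul_one] at hconst
  rw [Real.exp_neg, mul_inv_eq_one₀ (Real.exp_ne_zero _)] at hconst
  exact hconst

/-- For `s < 1` the finite sum with weights `s ^ n` is below the full series, whose exponent
increases in `s`; then let `s` tend to `1`. -/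
lemma sum_le_exp (h : SparreAndersen p q) (hq : Summable fun n : ℕ => q n / ((n : ℝ) + 1)) (m : ℕ) :
    ∑ n ∈ Finset.range m, p n ≤ Real.exp (∑' n : ℕ, q n / ((n : ℝ) + 1)) := by
  have hq' : Summable fun n : ℕ => q (n - 1) / n := by
    refine (summable_nat_add_iff 1).1 ?_
    simpa using hq
  have heq : ∑' n : ℕ, q (n - 1) / n = ∑' n : ℕ, q n / ((n : ℝ) + 1) := by
    rw [hq'.tsum_eq_zero_add]
    simp
  rw [← heq]
  have hlim : Tendsto (fun s : ℝ => ∑ n ∈ Finset.range m, p n * s ^ n) (𝓝[<] 1)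
      (𝓝 (∑ n ∈ Finset.range m, p n)) := by
    have : Continuous fun s : ℝ => ∑ n ∈ Finset.range m, p n * s ^ n := by fun_prop
    have h1 := this.tendsto 1
    simp only [one_pow, mul_one] at h1
    exact h1.mono_left nhdsWithin_le_nhds
  refine le_of_tendsto hlim ?_
  filter_upwards [Ioo_mem_nhdsLT (zero_lt_one (α := ℝ))] with s hs
  have hs' : |s| < 1 := by rw [abs_of_pos hs.1]; exact hs.2
  calc ∑ n ∈ Finset.range m, p n * s ^ n ≤ ∑' n, p n * s ^ n :=
        (summable_mul_pow h.abs_p_le hs').sum_le_tsum _ fun n _ =>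
          mul_nonneg (h.nonneg n) (pow_nonneg hs.1.le n)
    _ = Real.exp (∑' n : ℕ, q (n - 1) / n * s ^ n) := h.tsum_eq_exp hs'
    _ ≤ _ := by
        refine Real.exp_le_exp.2 (Summable.tsum_le_tsum (fun n => ?_)
          (summable_mul_pow h.abs_log_coeff_le hs') hq')
        exact mul_le_of_le_one_right (div_nonneg (h.q_nonneg _) (Nat.cast_nonneg n))
          (pow_le_one₀ hs.1.le hs.2.le)

lemma tendsto_exp (h : SparreAndersen p q) (hanti : Antitone p)
    (hq : Summable fun n : ℕ => (1 - q n) / ((n : ℝ) + 1)) :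
    Tendsto p atTop (𝓝 (Real.exp (-∑' n : ℕ, (1 - q n) / ((n : ℝ) + 1)))) := by
  have hconv : Tendsto p atTop (𝓝 (⨅ n, p n)) :=
    tendsto_atTop_ciInf hanti ⟨0, by rintro _ ⟨n, rfl⟩; exact h.nonneg n⟩
  -- Increments of `p`: their power series is `(1 - s) ∑ p n s^n`, and Abel's theorem sends it to
  -- `lim p`.
  let d : ℕ → ℝ := fun n => p n - if n = 0 then 0 else p (n - 1)
  have hdsum : ∀ n, ∑ i ∈ Finset.range (n + 1), d i = p n := by
    intro n
    induction n with
    | zero => simp [d]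
    | succ n ih => rw [Finset.sum_range_succ, ih]; simp [d]
  have hd : Tendsto (fun n => ∑ i ∈ Finset.range n, d i) atTop (𝓝 (⨅ n, p n)) := by
    rw [← tendsto_add_atTop_iff_nat 1]
    simpa only [hdsum] using hconv
  let b : ℕ → ℝ := fun n => if n = 0 then 0 else (1 - q (n - 1)) / n
  have hb : Summable b := by
    refine (summable_nat_add_iff 1).1 ?_
    simpa [b] using hq
  have hbeq : ∑' n, b n = ∑' n : ℕ, (1 - q n) / ((n : ℝ) + 1) := by
    rw [hb.tsum_eq_zero_add]
    simp [b]
  have h1 := Real.tendsto_tsum_powerSeries_nhdsWithin_lt hd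
  have h2 := Real.tendsto_tsum_powerSeries_nhdsWithin_lt hb.hasSum.tendsto_sum_nat
  have h3 := (Real.continuous_exp.tendsto _).comp h2.neg
  have heq : (fun s : ℝ => ∑' n, d n * s ^ n) =ᶠ[𝓝[<] 1]
      (Real.exp ∘ fun s : ℝ => -∑' n, b n * s ^ n) := by
    filter_upwards [Ioo_mem_nhdsLT (zero_lt_one (α := ℝ))] with s hs
    have hs' : |s| < 1 := by rw [abs_of_pos hs.1]; exact hs.2
    have hps := summable_mul_pow h.abs_p_le hs'
    have hqs := summable_mul_pow h.abs_log_coeff_le hs'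
    have hshift : HasSum (fun n : ℕ => (if n = 0 then 0 else p (n - 1)) * s ^ n)
        (s * ∑' n, p n * s ^ n) := by
      rw [← hasSum_nat_add_iff' 1]
      simpa [pow_succ, mul_assoc, mul_comm, mul_left_comm] using hps.hasSum.mul_left s
    have e1 : ∑' n, d n * s ^ n = (1 - s) * ∑' n, p n * s ^ n := by
      have := (hps.hasSum.sub hshift).tsum_eq
      simp only [d, sub_mul] at this ⊢
      rw [this]; ring
    -- Writing `1 - s` as `exp (log (1 - s))` turns the exponent into minus the series with
    -- coefficients `(1 - q (n - 1)) / n`, to which Abel's theorem applies as well.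
    have hlog : HasSum (fun n : ℕ => s ^ n / n) (-Real.log (1 - s)) := by
      rw [← hasSum_nat_add_iff' 1]
      simpa using Real.hasSum_pow_div_log_of_abs_lt_one hs'
    have e2 : ∑' n, b n * s ^ n = -Real.log (1 - s) - ∑' n : ℕ, q (n - 1) / n * s ^ n := by
      rw [← (hlog.sub hqs.hasSum).tsum_eq]
      refine tsum_congr fun n => ?_
      rcases n with _ | n
      · simp [b]
      · simp only [b, Nat.succ_ne_zero, if_false]
        ring
    simp only [Function.comp]
    rw [e1, e2, h.tsum_eq_exp hs', neg_sub, sub_neg_eq_add, Real.exp_add,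
      Real.exp_log (by linarith [hs.2]), mul_comm]
  have := tendsto_nhds_unique (h1.congr' heq) h3
  rw [this, hbeq] at hconv
  exact hconv

end SparreAndersen

lemma staysPositive_antitone : Antitone staysPositive :=
  fun _ _ hmn _ hx j h1 h2 => hx j h1 (h2.trans hmn)

lemma iidLaw_sparreAndersen (ν : Measure ℝ) [IsProbabilityMeasure ν] :
    SparreAndersen (fun n => (iidLaw ν).real (staysPositive n))
      (fun n => (iidLaw ν).real {x | 0 < partialSum x (n + 1)}) where
  zero := by
    have : staysPositive 0 = Set.univ := by
      ext x
      simp only [staysPositive, Set.mem_ofPred_eq, Set.mem_univ, iff_true]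
      intro j h1 h2; omega
    simp [this]
  nonneg _ := measureReal_nonneg
  le_one _ := measureReal_le_one
  q_nonneg _ := measureReal_nonneg
  q_le_one _ := measureReal_le_one
  recursion := sparreAndersen_recursion ν

/-! ### The standard normal distribution function -/

lemma Phi_eq_real (x : ℝ) : Phi x = (gaussianReal 0 1).real (Set.Iic x) := cdf_eq_real _ x

lemma Phi_mono : Monotone Phi := monotone_cdf _

lemma Phi_strictMono : StrictMono Phi := by
  intro x y hxy
  refine lt_of_le_of_ne (Phi_mono hxy.le) fun h => ?_
  have h1 : (gaussianReal 0 1).real (Set.Iic y \ Set.Iic x) = 0 := by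
    rw [measureReal_sdiff (Set.Iic_subset_Iic.2 hxy.le) measurableSet_Iic, ← Phi_eq_real,
      ← Phi_eq_real, h, sub_self]
  rw [measureReal_eq_zero_iff] at h1
  have h2 := gaussianReal_absolutelyContinuous' 0 one_ne_zero h1
  rw [Set.Iic_sdiff_Iic, Real.volume_Ioc] at h2
  simp at h2
  linarith

lemma Phi_pos (x : ℝ) : 0 < Phi x :=
  (cdf_nonneg _ (x - 1)).trans_lt (Phi_strictMono (by linarith))

lemma continuous_Phi : Continuous Phi := by
  rw [continuous_iff_continuousAt]
  intro x
  refine continuousAt_iff_continuous_left'_right'.2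
    ⟨?_, ((cdf (gaussianReal 0 1)).right_continuous x).mono Set.Ioi_subset_Ici_self⟩
  refine (monotone_cdf (gaussianReal 0 1)).continuousWithinAt_Iio_iff_leftLim_eq.2 ?_
  have h1 := (cdf (gaussianReal 0 1)).measure_singleton x
  have := nullSingletonClass_gaussianReal (μ := 0) (v := 1) one_ne_zero
  rw [measure_cdf, measure_singleton, eq_comm, ENNReal.ofReal_eq_zero] at h1
  exact le_antisymm ((monotone_cdf _).leftLim_le le_rfl) (by linarith)

/-- Chernoff bound with the optimal parameter `-x`. -/
lemma Phi_neg_le {x : ℝ} (hx : 0 ≤ x) : Phi (-x) ≤ Real.exp (-(x ^ 2 / 2)) := by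
  have h := measure_le_le_exp_mul_mgf (μ := gaussianReal 0 1) (X := id) (t := -x) (-x)
    (by linarith) (integrable_exp_mul_gaussianReal (-x))
  rw [mgf_id_gaussianReal, ← Real.exp_add] at h
  rw [Phi_eq_real]
  refine h.trans_eq ?_
  congr 1
  push_cast
  ring

/-! ### The function `C` -/

lemma C_term_nonneg (x : ℝ) (n : ℕ) :
    0 ≤ Phi (-(Real.sqrt ((n : ℝ) + 1) * x)) / ((n : ℝ) + 1) :=
  div_nonneg (Phi_pos _).le (by positivity)

lemma Phi_neg_sqrt_le {x : ℝ} (hx : 0 ≤ x) (n : ℕ) :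
    Phi (-(Real.sqrt ((n : ℝ) + 1) * x)) ≤ Real.exp (-(x ^ 2 / 2)) ^ (n + 1) := by
  refine (Phi_neg_le (by positivity)).trans_eq ?_
  rw [← Real.exp_nat_mul, mul_pow, Real.sq_sqrt (by positivity)]
  congr 1
  push_cast
  ring

lemma C_term_le {x : ℝ} (hx : 0 ≤ x) (n : ℕ) :
    Phi (-(Real.sqrt ((n : ℝ) + 1) * x)) / ((n : ℝ) + 1) ≤ Real.exp (-(x ^ 2 / 2)) ^ (n + 1) :=
  (div_le_self (Phi_pos _).le (by simp)).trans (Phi_neg_sqrt_le hx n)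

lemma exp_neg_sq_lt_one {x : ℝ} (hx : 0 < x) : Real.exp (-(x ^ 2 / 2)) < 1 :=
  by rw [← Real.exp_zero]; exact Real.exp_lt_exp.2 (by have := pow_pos hx 2; linarith)

lemma summable_exp_pow {x : ℝ} (hx : 0 < x) :
    Summable fun n : ℕ => Real.exp (-(x ^ 2 / 2)) ^ (n + 1) :=
  (summable_nat_add_iff 1).2
    (summable_geometric_of_lt_one (Real.exp_pos _).le (exp_neg_sq_lt_one hx))

lemma summable_C {x : ℝ} (hx : 0 < x) :
    Summable fun n : ℕ => Phi (-(Real.sqrt ((n : ℝ) + 1) * x)) / ((n : ℝ) + 1) :=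
  .of_nonneg_of_le (C_term_nonneg x) (C_term_le hx.le) (summable_exp_pow hx)

lemma C_pos (x : ℝ) : 0 < C x := Real.exp_pos _

lemma C_strictAntiOn : StrictAntiOn C (Set.Ioi 0) := by
  intro x hx y hy hxy
  have hlt : ∀ n : ℕ, Phi (-(Real.sqrt ((n : ℝ) + 1) * y)) / ((n : ℝ) + 1) <
      Phi (-(Real.sqrt ((n : ℝ) + 1) * x)) / ((n : ℝ) + 1) := by
    intro n
    have h0 : 0 < Real.sqrt ((n : ℝ) + 1) := Real.sqrt_pos.2 (by positivity)
    exact div_lt_div_of_pos_right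
      (Phi_strictMono (neg_lt_neg (mul_lt_mul_of_pos_left hxy h0))) (by positivity)
  exact Real.exp_lt_exp.2
    (Summable.tsum_lt_tsum (fun n => (hlt n).le) (hlt 0) (summable_C hy) (summable_C hx))

lemma continuousOn_C : ContinuousOn C (Set.Ioi 0) := by
  intro x hx
  have hx2 : 0 < x / 2 := half_pos hx
  refine ContinuousAt.continuousWithinAt ?_
  have h : ContinuousOn C (Set.Ioi (x / 2)) := by
    refine Real.continuous_exp.comp_continuousOn (continuousOn_tsum (fun n => ?_)
      (summable_exp_pow hx2) fun n y hy => ?_)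
    · exact ((continuous_Phi.comp (by fun_prop)).div_const _).continuousOn
    · have hy' : x / 2 ≤ y := le_of_lt hy
      rw [Real.norm_of_nonneg (C_term_nonneg y n)]
      refine (C_term_le (hx2.le.trans hy') n).trans (pow_le_pow_left₀ (Real.exp_pos _).le ?_ _)
      exact Real.exp_le_exp.2 (by have := pow_le_pow_left₀ hx2.le hy' 2; linarith)
  exact h.continuousAt (Ioi_mem_nhds (half_lt_self hx))

/-- `C` is unbounded near `0`. -/
lemma exists_lt_C (c : ℝ) {y : ℝ} (hy : 0 < y) : ∃ x ∈ Set.Ioo 0 y, c < C x := by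
  have hφ := Phi_pos (-1)
  obtain ⟨N, hN⟩ := (Real.tendsto_sum_range_one_div_nat_succ_atTop.eventually_gt_atTop
    (c / Phi (-1))).exists
  have hs : 0 < Real.sqrt ((N : ℝ) + 1) := Real.sqrt_pos.2 (by positivity)
  -- With this `x`, every index `i < N` has `√(i + 1) x ≤ 1`, so the series dominates `Phi (-1)`
  -- times a harmonic sum, chosen to exceed `c`.
  have hx : 0 < min (y / 2) (Real.sqrt ((N : ℝ) + 1))⁻¹ := lt_min (half_pos hy) (inv_pos.2 hs)
  refine ⟨_, ⟨hx, (min_le_left _ _).trans_lt (half_lt_self hy)⟩, ?_⟩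
  set x := min (y / 2) (Real.sqrt ((N : ℝ) + 1))⁻¹
  have h1 : c < Phi (-1) * ∑ i ∈ Finset.range N, 1 / ((i : ℝ) + 1) := by
    rwa [div_lt_iff₀ hφ, mul_comm] at hN
  have h2 : Phi (-1) * ∑ i ∈ Finset.range N, 1 / ((i : ℝ) + 1) ≤
      ∑' n : ℕ, Phi (-(Real.sqrt ((n : ℝ) + 1) * x)) / ((n : ℝ) + 1) := by
    refine le_trans ?_ ((summable_C hx).sum_le_tsum (Finset.range N) fun n _ => C_term_nonneg x n)
    rw [Finset.mul_sum]
    refine Finset.sum_le_sum fun i hi => ?_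
    rw [mul_one_div]
    refine div_le_div_of_nonneg_right (Phi_mono (neg_le_neg ?_)) (by positivity)
    have hiN : (i : ℝ) + 1 ≤ (N : ℝ) + 1 := by
      have : (i : ℝ) ≤ N := by exact_mod_cast (Finset.mem_range.1 hi).le
      linarith
    calc Real.sqrt ((i : ℝ) + 1) * x ≤
          Real.sqrt ((N : ℝ) + 1) * (Real.sqrt ((N : ℝ) + 1))⁻¹ :=
          mul_le_mul (Real.sqrt_le_sqrt hiN) (min_le_right _ _) hx.le hs.le
      _ = 1 := mul_inv_cancel₀ hs.ne'
  have h3 := Real.add_one_le_exp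
    (∑' n : ℕ, Phi (-(Real.sqrt ((n : ℝ) + 1) * x)) / ((n : ℝ) + 1))
  unfold C
  linarith

lemma exists_C_eq {c y : ℝ} (hy : 0 < y) (hc : C y < c) : ∃ x ∈ Set.Ioo 0 y, C x = c := by
  obtain ⟨x₀, hx₀, hlt⟩ := exists_lt_C c hy
  obtain ⟨x, hx, hxc⟩ := intermediate_value_Ioo' hx₀.2.le
    (continuousOn_C.mono fun z hz => hx₀.1.trans_le hz.1) ⟨hc, hlt⟩
  exact ⟨x, ⟨hx₀.1.trans hx.1, hx.2⟩, hxc⟩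

lemma existsUnique_gap {γ σbar c : ℝ} (hγ : 0 < γ) (hσbar : 0 < σbar) (hc : C (γ / σbar) < c) :
    ∃! γ₀ : ℝ, γ₀ ∈ Set.Ioo 0 γ ∧ C ((γ - γ₀) / σbar) = c := by
  obtain ⟨x, hx, hxc⟩ := exists_C_eq (div_pos hγ hσbar) hc
  refine ⟨γ - x * σbar, ⟨⟨?_, ?_⟩, ?_⟩, ?_⟩
  · have := (lt_div_iff₀ hσbar).1 hx.2
    linarith
  · have := mul_pos hx.1 hσbar
    linarith
  · rw [sub_sub_cancel, mul_div_cancel_right₀ _ hσbar.ne', hxc]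
  · rintro g ⟨hg, hgc⟩
    have h := C_strictAntiOn.injOn (x₁ := (γ - g) / σbar)
      (div_pos (by linarith [hg.2]) hσbar) hx.1 (hgc.trans hxc.symm)
    rw [div_eq_iff hσbar.ne'] at h
    linarith

/-! ### Gaussian random walks -/

lemma gaussianReal_real_Iic_zero (m : ℝ) {σ : ℝ≥0} (hσ : σ ≠ 0) :
    (gaussianReal m (σ ^ 2)).real (Set.Iic 0) = Phi (-(m / σ)) := by
  have hσ' : (0 : ℝ) < σ := by positivity
  have h : gaussianReal m (σ ^ 2) = (gaussianReal 0 1).map fun x => (σ : ℝ) * x + m := by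
    rw [show (fun x : ℝ => (σ : ℝ) * x + m) = (fun x => x + m) ∘ fun x => (σ : ℝ) * x from rfl,
      ← Measure.map_map (by fun_prop) (by fun_prop), gaussianReal_map_const_mul,
      gaussianReal_map_add_const]
    simp
    congr 1
  rw [h, map_measureReal_apply (by fun_prop) measurableSet_Iic, Phi_eq_real]
  congr 1
  ext x
  simp only [Set.mem_preimage, Set.mem_Iic]
  rw [← neg_div, le_div_iff₀ hσ']
  constructor <;> intro h <;> linarith

/-- With mean at most `-δ`, the positive tail is largest for mean `-δ` and deviation `τ`; for `σ =
0` it vanishes. -/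
lemma gaussianReal_real_Ioi_zero_le {m δ τ : ℝ} {σ : ℝ≥0} (hδ : 0 < δ) (hm : m ≤ -δ)
    (hσ : (σ : ℝ) ≤ τ) : (gaussianReal m (σ ^ 2)).real (Set.Ioi 0) ≤ Phi (-(δ / τ)) := by
  rcases eq_or_ne σ 0 with rfl | hσ0
  · have h : (gaussianReal m (0 ^ 2)).real (Set.Ioi 0) = 0 := by
      rw [zero_pow two_ne_zero, gaussianReal_zero_var, measureReal_eq_zero_iff,
        Measure.dirac_apply' _ measurableSet_Ioi]
      simp; linarith
    rw [h]
    exact (Phi_pos _).le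
  · have hσ' : (0 : ℝ) < σ := by positivity
    have h : gaussianReal m (σ ^ 2) = (gaussianReal 0 1).map fun x => m - (σ : ℝ) * x := by
      rw [show (fun x : ℝ => m - (σ : ℝ) * x) = (fun x => m - x) ∘ fun x => (σ : ℝ) * x from rfl,
        ← Measure.map_map (by fun_prop) (by fun_prop), gaussianReal_map_const_mul,
        gaussianReal_map_const_sub]
      simp
      congr 1
    rw [h, map_measureReal_apply (by fun_prop) measurableSet_Ioi, Phi_eq_real]
    refine measureReal_mono fun x hx => ?_
    simp only [Set.mem_preimage, Set.mem_Ioi, Set.mem_Iic] at hx ⊢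
    have h1 : x < -(δ / σ) := by
      rw [← neg_div, lt_div_iff₀ hσ']
      linarith
    have h2 : δ / τ ≤ δ / σ := div_le_div_of_nonneg_left hδ.le hσ' hσ
    linarith

lemma map_partialSum_gaussian (d : ℝ) (v : ℝ≥0) (n : ℕ) :
    (iidLaw (gaussianReal d v)).map (fun x => partialSum x n) =
      gaussianReal (n * d) (n * v) := by
  have hind : iIndepFun (fun (i : ℕ) (x : ℕ → ℝ) => x i) (iidLaw (gaussianReal d v)) :=
    iIndepFun_infinitePi (P := fun _ : ℕ => gaussianReal d v) (X := fun _ x => x)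
      fun _ => measurable_id
  induction n with
  | zero => simp [partialSum, Measure.map_const]
  | succ n ih =>
    have h1 : IndepFun (fun x : ℕ → ℝ => partialSum x n) (fun x => x n)
        (iidLaw (gaussianReal d v)) := by
      have := hind.indepFun_sum_range_succ (fun i => measurable_pi_apply i) n
      convert this using 1
      ext x
      simp [partialSum]
    have h2 : (iidLaw (gaussianReal d v)).map (fun x => x n) = gaussianReal d v :=
      Measure.infinitePi_map_eval (fun _ : ℕ => gaussianReal d v) n
    have h3 := gaussianReal_add_gaussianReal_of_indepFun h1 ih h2
    have h4 : (fun x : ℕ → ℝ => partialSum x (n + 1)) =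
        (fun x => partialSum x n) + fun x => x n := by
      ext x
      simp [partialSum, Finset.sum_range_succ]
    rw [h4, h3]
    congr 1 <;> push_cast <;> ring

lemma map_partialSum_gaussian_succ (d : ℝ) (σ : ℝ≥0) (n : ℕ) :
    (iidLaw (gaussianReal d (σ ^ 2))).map (fun x => partialSum x (n + 1)) =
      gaussianReal (((n : ℝ) + 1) * d) ((NNReal.sqrt (n + 1) * σ) ^ 2) := by
  rw [map_partialSum_gaussian, mul_pow, NNReal.sq_sqrt]
  push_cast
  rfl

lemma iidLaw_gaussian_partialSum_nonpos (d : ℝ) {σ : ℝ≥0} (hσ : σ ≠ 0) (n : ℕ) :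
    1 - (iidLaw (gaussianReal d (σ ^ 2))).real {x | 0 < partialSum x (n + 1)} =
      Phi (-(Real.sqrt ((n : ℝ) + 1) * (d / σ))) := by
  have hs : NNReal.sqrt ((n : ℝ≥0) + 1) ≠ 0 := by simp
  have hm : MeasurableSet {x : ℕ → ℝ | 0 < partialSum x (n + 1)} :=
    measurableSet_lt measurable_const (measurable_partialSum _)
  rw [← probReal_compl_eq_one_sub hm]
  have h := gaussianReal_real_Iic_zero (((n : ℝ) + 1) * d) (mul_ne_zero hs hσ)
  rw [← map_partialSum_gaussian_succ, map_measureReal_apply (measurable_partialSum _)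
    measurableSet_Iic] at h
  convert h using 2
  · ext x; simp
  · have hσ' : (0 : ℝ) < σ := by positivity
    have h0 : 0 < Real.sqrt ((n : ℝ) + 1) := Real.sqrt_pos.2 (by positivity)
    push_cast
    rw [neg_inj, eq_div_iff (by positivity)]
    have := Real.mul_self_sqrt (show (0 : ℝ) ≤ (n : ℝ) + 1 by positivity)
    field_simp
    linear_combination d * this

lemma iidLaw_gaussian_partialSum_pos_le {d δ τ : ℝ} {σ : ℝ≥0} (hδ : 0 < δ) (hd : d ≤ -δ)
    (hτ : 0 < τ) (hσ : (σ : ℝ) ≤ τ) (n : ℕ) :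
    (iidLaw (gaussianReal d (σ ^ 2))).real {x | 0 < partialSum x (n + 1)} ≤
      Phi (-(Real.sqrt ((n : ℝ) + 1) * (δ / τ))) := by
  have h0 : 0 < Real.sqrt ((n : ℝ) + 1) := Real.sqrt_pos.2 (by positivity)
  have h := gaussianReal_real_Ioi_zero_le (m := ((n : ℝ) + 1) * d) (δ := ((n : ℝ) + 1) * δ)
    (τ := Real.sqrt ((n : ℝ) + 1) * τ) (σ := NNReal.sqrt (n + 1) * σ) (by positivity)
    (by nlinarith) (by push_cast; gcongr)
  rw [← map_partialSum_gaussian_succ, map_measureReal_apply (measurable_partialSum _)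
    measurableSet_Ioi] at h
  refine h.trans_eq (congrArg (fun t => Phi (-t)) (Eq.symm ?_))
  have := Real.mul_self_sqrt (show (0 : ℝ) ≤ (n : ℝ) + 1 by positivity)
  rw [eq_div_iff (by positivity)]
  field_simp
  linear_combination this

/-- The probability that all partial sums of a Gaussian random walk with positive drift are
positive. -/
lemma iidLaw_gaussian_forall_pos {d : ℝ} (hd : 0 < d) {σ : ℝ≥0} (hσ : σ ≠ 0) :
    (iidLaw (gaussianReal d (σ ^ 2))).real {x | ∀ n, 1 ≤ n → 0 < partialSum x n} =
      (C (d / σ))⁻¹ := by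
  have hσ' : (0 : ℝ) < σ := by positivity
  have heq : {x : ℕ → ℝ | ∀ n, 1 ≤ n → 0 < partialSum x n} = ⋂ n, staysPositive n := by
    ext x
    simp only [staysPositive, Set.mem_ofPred_eq, Set.mem_iInter]
    exact ⟨fun h n j h1 _ => h j h1, fun h n hn => h n n hn le_rfl⟩
  have h1 := tendsto_measure_iInter_atTop (μ := iidLaw (gaussianReal d (σ ^ 2)))
    (fun n => (measurableSet_staysPositive n).nullMeasurableSet) staysPositive_antitone
    ⟨0, measure_ne_top _ _⟩
  rw [← heq] at h1
  have h2 := (ENNReal.tendsto_toReal (measure_ne_top _ _)).comp h1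
  have h3 := (iidLaw_sparreAndersen (gaussianReal d (σ ^ 2))).tendsto_exp
    (fun m n hmn => measureReal_mono (staysPositive_antitone hmn))
  simp only [iidLaw_gaussian_partialSum_nonpos d hσ] at h3
  have h4 := tendsto_nhds_unique h2 (h3 (summable_C (div_pos hd hσ')))
  rw [Real.exp_neg] at h4
  exact h4

/-- The left side is the truncated mean of the first passage time to `(-∞, 0]`. -/
lemma sum_iidLaw_gaussian_staysPositive_le {d δ τ : ℝ} {σ : ℝ≥0} (hδ : 0 < δ) (hd : d ≤ -δ)
    (hτ : 0 < τ) (hσ : (σ : ℝ) ≤ τ) (m : ℕ) :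
    ∑ n ∈ Finset.range m, (iidLaw (gaussianReal d (σ ^ 2))).real (staysPositive n) ≤
      C (δ / τ) := by
  have hle : ∀ n : ℕ, (iidLaw (gaussianReal d (σ ^ 2))).real {x | 0 < partialSum x (n + 1)} /
      ((n : ℝ) + 1) ≤ Phi (-(Real.sqrt ((n : ℝ) + 1) * (δ / τ))) / ((n : ℝ) + 1) := fun n =>
    div_le_div_of_nonneg_right (iidLaw_gaussian_partialSum_pos_le hδ hd hτ hσ n) (by positivity)
  have hs := summable_C (div_pos hδ hτ)
  have hs' := Summable.of_nonneg_of_le (fun n => div_nonneg measureReal_nonneg (by positivity))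
    hle hs
  exact ((iidLaw_sparreAndersen _).sum_le_exp hs' m).trans
    (Real.exp_le_exp.2 (hs'.tsum_le_tsum hle hs))

/-- Only the last partial sum is used; the geometric decay serves the second moment bound. -/
lemma iidLaw_gaussian_staysPositive_le {d δ τ : ℝ} {σ : ℝ≥0} (hδ : 0 < δ) (hd : d ≤ -δ)
    (hτ : 0 < τ) (hσ : (σ : ℝ) ≤ τ) (n : ℕ) :
    (iidLaw (gaussianReal d (σ ^ 2))).real (staysPositive n) ≤
      Real.exp (-((δ / τ) ^ 2 / 2)) ^ n := by
  rcases n with _ | n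
  · simp [measureReal_le_one]
  · calc (iidLaw (gaussianReal d (σ ^ 2))).real (staysPositive (n + 1))
        ≤ (iidLaw (gaussianReal d (σ ^ 2))).real {x | 0 < partialSum x (n + 1)} :=
          measureReal_mono fun x hx => hx (n + 1) (by omega) le_rfl
      _ ≤ _ := iidLaw_gaussian_partialSum_pos_le hδ hd hτ hσ n
      _ ≤ _ := Phi_neg_sqrt_le (div_pos hδ hτ).le n

/-! ### The greedy procedure along a fixed array of observations -/

lemma partialSum_sub_const (y : ℕ → ℝ) (a : ℝ) {n : ℕ} (hn : 1 ≤ n) :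
    partialSum (fun j => y j - a) n = n * (runningAverage y n - a) := by
  have : (n : ℝ) ≠ 0 := by positivity
  simp only [partialSum, runningAverage, Finset.sum_sub_distrib, Finset.sum_const,
    Finset.card_range, nsmul_eq_mul]
  field_simp

lemma partialSum_sub_const_pos_iff (y : ℕ → ℝ) (a : ℝ) {n : ℕ} (hn : 1 ≤ n) :
    0 < partialSum (fun j => y j - a) n ↔ a < runningAverage y n := by
  have : (0 : ℝ) < n := by positivity
  rw [partialSum_sub_const y a hn, mul_pos_iff_of_pos_left this, sub_pos]

/-- Either all running averages after the `N`-th one exceed it, or all running averages agree. -/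
def SettlesAt (y : ℕ → ℝ) (N : ℕ) : Prop :=
  (∀ n, N < n → runningAverage y N < runningAverage y n) ∨
    ∀ n, 1 ≤ n → runningAverage y n = runningAverage y 1

/-- The number of `l < T` such that the first `l` partial sums are positive. -/
def stayCount (T : ℕ) (y : ℕ → ℝ) : ℝ :=
  ∑ l ∈ Finset.range T, (staysPositive l).indicator 1 y

lemma le_stayCount {T n : ℕ} {y : ℕ → ℝ} (hn : n ≤ T) (h : ∀ l < n, y ∈ staysPositive l) :
    (n : ℝ) ≤ stayCount T y := by
  calc (n : ℝ) = ∑ l ∈ Finset.range n, (staysPositive l).indicator (1 : (ℕ → ℝ) → ℝ) y := by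
        rw [Finset.sum_congr rfl fun l hl =>
          Set.indicator_of_mem (h l (Finset.mem_range.1 hl)) (1 : (ℕ → ℝ) → ℝ)]
        simp
    _ ≤ _ := Finset.sum_le_sum_of_subset_of_nonneg (by simpa using hn) fun l _ _ =>
        Set.indicator_nonneg (fun _ _ => zero_le_one) _

section Greedy

variable {ι : Type*} [DecidableEq ι] [MeasurableSpace ι] (r : ArgmaxRule ι) (x : ι → ℕ → ℝ)

/-- The alternative which the greedy procedure observes in its `t`-th greedy step. -/
def greedyPick (t : ℕ) : ι := r.pick fun i => runningAverage (x i) (greedySizes r x t i)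

lemma greedySizes_succ (t : ℕ) :
    greedySizes r x (t + 1) =
      Function.update (greedySizes r x t) (greedyPick r x t)
        (greedySizes r x t (greedyPick r x t) + 1) := rfl

lemma le_greedyPick (t : ℕ) (i : ι) :
    runningAverage (x i) (greedySizes r x t i) ≤
      runningAverage (x (greedyPick r x t)) (greedySizes r x t (greedyPick r x t)) :=
  r.le_pick (fun i => runningAverage (x i) (greedySizes r x t i)) i

lemma greedySizes_succ_self (t : ℕ) :
    greedySizes r x (t + 1) (greedyPick r x t) = greedySizes r x t (greedyPick r x t) + 1 := by
  rw [greedySizes_succ, Function.update_self]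

lemma greedySizes_succ_of_ne {t : ℕ} {i : ι} (h : i ≠ greedyPick r x t) :
    greedySizes r x (t + 1) i = greedySizes r x t i := by
  rw [greedySizes_succ, Function.update_of_ne h]

lemma one_le_greedySizes (t : ℕ) (i : ι) : 1 ≤ greedySizes r x t i := by
  induction t with
  | zero => exact le_rfl
  | succ t ih =>
    by_cases h : i = greedyPick r x t
    · subst h; rw [greedySizes_succ_self]; omega
    · rwa [greedySizes_succ_of_ne r x h]

lemma sum_greedySizes [Fintype ι] (t : ℕ) :
    ∑ i, greedySizes r x t i = Fintype.card ι + t := by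
  induction t with
  | zero => simp [greedySizes]
  | succ t ih =>
    rw [greedySizes_succ, Finset.sum_update_of_mem (Finset.mem_univ _), ← add_assoc, ← ih,
      ← Finset.add_sum_erase _ _ (Finset.mem_univ (greedyPick r x t)), Finset.erase_eq]
    omega

variable {r x}

/-- An alternative is observed again only while its running averages exceed a lower bound of the
running averages of `i₀`. -/
lemma lt_runningAverage_of_lt_greedySizes {i₀ : ι} {a : ℝ}
    (ha : ∀ n, 1 ≤ n → a < runningAverage (x i₀) n) (t : ℕ) (i : ι) {l : ℕ} (hl : 1 ≤ l)
    (hlt : l < greedySizes r x t i) : a < runningAverage (x i) l := by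
  induction t with
  | zero => simp only [greedySizes] at hlt; omega
  | succ t ih =>
    by_cases h : i = greedyPick r x t
    · subst h
      rw [greedySizes_succ_self] at hlt
      rcases Nat.lt_or_ge l (greedySizes r x t (greedyPick r x t)) with h1 | h1
      · exact ih h1
      · rw [show l = greedySizes r x t (greedyPick r x t) by omega]
        exact (ha _ (one_le_greedySizes r x t i₀)).trans_le (le_greedyPick r x t i₀)
    · rw [greedySizes_succ_of_ne r x h] at hlt
      exact ih hlt

lemma greedyPick_eq_of_lt {i₀ : ι} {N : ℕ}
    (hN : ∀ n, N < n → runningAverage (x i₀) N < runningAverage (x i₀) n) (t : ℕ)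
    (ht : N < greedySizes r x t i₀) (hN1 : 1 ≤ N) : greedyPick r x t = i₀ := by
  -- When `i₀` receives its observation number `N + 1`, its `N`-th average is the largest current
  -- one. Afterwards `i₀` strictly exceeds that value, so the other averages stay frozen below it.
  have inv : ∀ t, N < greedySizes r x t i₀ → ∀ i, i ≠ i₀ →
      runningAverage (x i) (greedySizes r x t i) ≤ runningAverage (x i₀) N := by
    intro t
    induction t with
    | zero => intro h; simp only [greedySizes] at h; omega
    | succ t ih =>
      intro h i hi
      by_cases hlt : N < greedySizes r x t i₀
      · have hpick : greedyPick r x t = i₀ := by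
          by_contra hne
          have h1 := ih hlt _ hne
          have h2 := le_greedyPick r x t i₀
          have h3 := hN _ hlt
          linarith
        rw [greedySizes_succ_of_ne r x (by rwa [hpick])]
        exact ih hlt i hi
      · have hpick : greedyPick r x t = i₀ := by
          by_contra hne
          rw [greedySizes_succ_of_ne r x (Ne.symm hne)] at h
          exact hlt h
        have hself := greedySizes_succ_self r x t
        rw [hpick] at hself
        have hval : greedySizes r x t i₀ = N := by omega
        rw [greedySizes_succ_of_ne r x (by rwa [hpick])]
        have := le_greedyPick r x t i
        rwa [hpick, hval] at this
  by_contra hne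
  have h1 := inv t ht _ hne
  have h2 := le_greedyPick r x t i₀
  have h3 := hN _ ht
  linarith

/-- Observing `i₀` leaves the vector of averages unchanged, and the tie-breaking depends on that
vector alone, so the same choice recurs. -/
lemma greedyPick_eq_of_const {i₀ : ι}
    (hN : ∀ n, 1 ≤ n → runningAverage (x i₀) n = runningAverage (x i₀) 1) (t : ℕ)
    (ht : 1 < greedySizes r x t i₀) : greedyPick r x t = i₀ := by
  have step : ∀ t, greedyPick r x t = i₀ → greedyPick r x (t + 1) = i₀ := by
    intro t hpick
    rw [← hpick]
    conv_rhs => rw [greedyPick]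
    rw [greedyPick]
    congr 1
    ext i
    by_cases h : i = i₀
    · subst h
      rw [hN _ (one_le_greedySizes r x _ _), hN _ (one_le_greedySizes r x _ _)]
    · rw [greedySizes_succ_of_ne r x (by rwa [hpick])]
  induction t with
  | zero => simp only [greedySizes] at ht; omega
  | succ t ih =>
    refine step t ?_
    by_contra hne
    rw [greedySizes_succ_of_ne r x (Ne.symm hne)] at ht
    exact hne (ih ht)

/-- The greedy procedure selects `i₀` if the running averages of `i₀` stay above `a` and settle
within `K` observations, and the budget suffices to push the other running averages below `a`. -/
lemma greedySelect_eq [Fintype ι] {i₀ : ι} {a : ℝ} {K B : ℕ}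
    (ha : ∀ n, 1 ≤ n → a < runningAverage (x i₀) n)
    (hK : ∃ N, 1 ≤ N ∧ N ≤ K ∧ SettlesAt (x i₀) N) (hcard : Fintype.card ι ≤ B)
    (hB : ∑ i ∈ Finset.univ.erase i₀, stayCount B (fun j => x i j - a) + K < B) :
    greedySelect r x B = i₀ := by
  obtain ⟨N, hN1, hNK, hN⟩ := hK
  change greedyPick r x (B - Fintype.card ι) = i₀
  set t := B - Fintype.card ι with ht
  have hsum : ∑ i, greedySizes r x t i = B := by rw [sum_greedySizes]; omega
  have hle : ∀ i, (greedySizes r x t i : ℝ) ≤ stayCount B fun j => x i j - a := by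
    intro i
    refine le_stayCount ?_ fun l hl j hj1 hj2 => ?_
    · rw [← hsum]
      exact Finset.single_le_sum (f := greedySizes r x t) (fun _ _ => Nat.zero_le _)
        (Finset.mem_univ i)
    · exact (partialSum_sub_const_pos_iff _ _ hj1).2
        (lt_runningAverage_of_lt_greedySizes ha t i hj1 (hj2.trans_lt hl))
  -- Whatever part of the budget the others cannot consume goes to `i₀`.
  have hlt : K < greedySizes r x t i₀ := by
    have h1 : ((∑ i, greedySizes r x t i : ℕ) : ℝ) = B := by rw [hsum]
    rw [← Finset.add_sum_erase _ _ (Finset.mem_univ i₀)] at h1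
    push_cast at h1
    have h2 : ∑ i ∈ Finset.univ.erase i₀, (greedySizes r x t i : ℝ) ≤
      ∑ i ∈ Finset.univ.erase i₀, stayCount B (fun j => x i j - a) :=
      Finset.sum_le_sum fun i _ => hle i
    have h3 : (K : ℝ) < greedySizes r x t i₀ := by linarith
    exact_mod_cast h3
  rcases hN with hN | hN
  · exact greedyPick_eq_of_lt hN t (by omega) hN1
  · exact greedyPick_eq_of_const hN t (by omega)

end Greedy

/-! ### Laws of the observations -/

lemma map_sub_const_iidLaw (m a : ℝ) (v : ℝ≥0) :
    (iidLaw (gaussianReal m v)).map (fun y j => y j - a) = iidLaw (gaussianReal (m - a) v) := by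
  have h := Measure.infinitePi_map_pi (fun _ : ℕ => gaussianReal m v)
    (f := fun _ y => y - a) fun _ => by fun_prop
  rw [gaussianReal_map_sub_const] at h
  exact h

section Observations

variable {Ω ι : Type*} [MeasurableSpace Ω] {P : Measure Ω} {X : ι → ℕ → Ω → ℝ} {μ : ι → ℝ}
  {σ : ι → ℝ≥0}

lemma NormalObservations.measurable_row (hX : NormalObservations P X μ σ) (i : ι) :
    Measurable fun ω j => X i j ω :=
  measurable_pi_lambda _ fun j => hX.measurable i j

lemma NormalObservations.map_row (hX : NormalObservations P X μ σ) (i : ι) :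
    P.map (fun ω j => X i j ω) = iidLaw (gaussianReal (μ i) (σ i ^ 2)) := by
  have h : iIndepFun (X i) P := hX.indep.precomp (g := fun j => (i, j)) (Prod.mk_right_injective i)
  rw [h.map_fun_eq_infinitePi_map (hX.measurable i)]
  simp only [hX.law, iidLaw]

lemma NormalObservations.measurable_row_sub (hX : NormalObservations P X μ σ) (a : ℝ) (i : ι) :
    Measurable fun ω j => X i j ω - a :=
  measurable_pi_lambda _ fun j => (hX.measurable i j).sub_const a

lemma NormalObservations.map_row_sub (hX : NormalObservations P X μ σ) (a : ℝ) (i : ι) :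
    P.map (fun ω j => X i j ω - a) = iidLaw (gaussianReal (μ i - a) (σ i ^ 2)) := by
  rw [← map_sub_const_iidLaw, ← hX.map_row i,
    Measure.map_map (by fun_prop) (hX.measurable_row i)]
  rfl

lemma NormalObservations.iIndepFun_row [IsProbabilityMeasure P] (hX : NormalObservations P X μ σ) :
    iIndepFun (fun i ω j => X i j ω) P := by
  rw [iIndepFun_iff_map_fun_eq_infinitePi_map hX.measurable_row]
  have h := hX.indep.map_fun_eq_infinitePi_map (fun p : ι × ℕ => hX.measurable p.1 p.2)
  simp only [hX.law] at h
  simp only [hX.map_row]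
  have h2 := Measure.infinitePi_map_curry (fun (i : ι) (_ : ℕ) => gaussianReal (μ i) (σ i ^ 2))
  rw [← h, Measure.map_map (by fun_prop)
    (measurable_pi_lambda _ fun p : ι × ℕ => hX.measurable p.1 p.2)] at h2
  exact h2

end Observations

/-! ### Moments of the number of positive steps -/

lemma measurable_stayCount (T : ℕ) : Measurable (stayCount T) :=
  Finset.measurable_fun_sum _ fun l _ =>
    (measurable_const (a := (1 : ℝ))).indicator (measurableSet_staysPositive l)

lemma stayCount_nonneg (T : ℕ) (y : ℕ → ℝ) : 0 ≤ stayCount T y :=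
  Finset.sum_nonneg fun _ _ => Set.indicator_nonneg (fun _ _ => zero_le_one) _

lemma stayCount_le (T : ℕ) (y : ℕ → ℝ) : stayCount T y ≤ T := by
  calc stayCount T y ≤ ∑ _l ∈ Finset.range T, (1 : ℝ) :=
        Finset.sum_le_sum fun l _ => Set.indicator_le_self' (fun _ _ => zero_le_one) y
    _ = T := by simp

lemma memLp_stayCount {Ω : Type*} [MeasurableSpace Ω] (P : Measure Ω) [IsFiniteMeasure P]
    (T : ℕ) {f : Ω → ℕ → ℝ} (hf : Measurable f) :
    MemLp (fun ω => stayCount T (f ω)) 2 P :=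
  memLp_of_bounded (a := 0) (b := T)
    (Eventually.of_forall fun _ => ⟨stayCount_nonneg T _, stayCount_le T _⟩)
    ((measurable_stayCount T).comp hf).aestronglyMeasurable 2

lemma integral_stayCount (Q : Measure (ℕ → ℝ)) [IsFiniteMeasure Q] (T : ℕ) :
    ∫ y, stayCount T y ∂Q = ∑ l ∈ Finset.range T, Q.real (staysPositive l) := by
  unfold stayCount
  rw [integral_finsetSum]
  · exact Finset.sum_congr rfl fun l _ => integral_indicator_one (measurableSet_staysPositive l)
  · exact fun l _ => (integrable_const (1 : ℝ)).indicator (measurableSet_staysPositive l)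

lemma integral_stayCount_sq (Q : Measure (ℕ → ℝ)) [IsFiniteMeasure Q] (T : ℕ) :
    ∫ y, stayCount T y ^ 2 ∂Q =
      ∑ l ∈ Finset.range T, ∑ n ∈ Finset.range T, Q.real (staysPositive (max l n)) := by
  have h : ∀ y, stayCount T y ^ 2 = ∑ l ∈ Finset.range T, ∑ n ∈ Finset.range T,
      (staysPositive (max l n)).indicator (1 : (ℕ → ℝ) → ℝ) y := by
    intro y
    rw [sq, stayCount, Finset.sum_mul_sum]
    refine Finset.sum_congr rfl fun l _ => Finset.sum_congr rfl fun n _ => ?_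
    have hmax : staysPositive (max l n) = staysPositive l ∩ staysPositive n := by
      ext y
      refine ⟨fun hy => ⟨staysPositive_antitone (le_max_left _ _) hy,
        staysPositive_antitone (le_max_right _ _) hy⟩, fun hy => ?_⟩
      rcases max_choice l n with h | h <;> rw [h]
      exacts [hy.1, hy.2]
    rw [hmax, Set.inter_indicator_one, Pi.mul_apply]
  have hint : ∀ l, Integrable ((staysPositive l).indicator (1 : (ℕ → ℝ) → ℝ)) Q := fun l =>
    (integrable_const (1 : ℝ)).indicator (measurableSet_staysPositive l)
  simp only [h]
  rw [integral_finsetSum _ fun l _ => integrable_finsetSum _ fun n _ => hint _]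
  refine Finset.sum_congr rfl fun l _ => ?_
  rw [integral_finsetSum _ fun n _ => hint _]
  exact Finset.sum_congr rfl fun n _ => integral_indicator_one (measurableSet_staysPositive _)

lemma sum_geometric_range_le {θ : ℝ} (h0 : 0 ≤ θ) (h1 : θ < 1) (T : ℕ) :
    ∑ l ∈ Finset.range T, θ ^ l ≤ (1 - θ)⁻¹ := by
  rw [← tsum_geometric_of_lt_one h0 h1]
  exact (summable_geometric_of_lt_one h0 h1).sum_le_tsum _ fun l _ => pow_nonneg h0 l

/-- The second moments of `stayCount` are bounded uniformly in the truncation level and over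
Gaussian walks with uniformly negative drift and bounded variance. -/
lemma exists_integral_stayCount_sq_le {δ τ : ℝ} (hδ : 0 < δ) (hτ : 0 < τ) :
    ∃ V : ℝ, ∀ (d : ℝ) (σ : ℝ≥0) (T : ℕ), d ≤ -δ → (σ : ℝ) ≤ τ →
      ∫ y, stayCount T y ^ 2 ∂iidLaw (gaussianReal d (σ ^ 2)) ≤ V := by
  set ρ := Real.exp (-((δ / τ) ^ 2 / 2)) with hρ
  -- The square root makes the double sum factor: `ρ ^ max l n = θ ^ (2 * max l n) ≤ θ ^ l * θ ^ n`.
  set θ := Real.sqrt ρ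
  have hρ0 : 0 < ρ := Real.exp_pos _
  have hθρ : θ ^ 2 = ρ := Real.sq_sqrt hρ0.le
  have hθ0 : 0 ≤ θ := Real.sqrt_nonneg _
  have hθ1 : θ < 1 := by
    rw [← Real.sqrt_one]
    exact Real.sqrt_lt_sqrt hρ0.le (exp_neg_sq_lt_one (div_pos hδ hτ))
  refine ⟨(1 - θ)⁻¹ * (1 - θ)⁻¹, fun d σ T hd hσ => ?_⟩
  rw [integral_stayCount_sq]
  calc _ ≤ ∑ l ∈ Finset.range T, ∑ n ∈ Finset.range T, θ ^ l * θ ^ n := by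
        refine Finset.sum_le_sum fun l _ => Finset.sum_le_sum fun n _ => ?_
        refine (iidLaw_gaussian_staysPositive_le hδ hd hτ hσ _).trans ?_
        rw [← hρ, ← hθρ, ← pow_mul, ← pow_add]
        refine pow_le_pow_of_le_one hθ0 hθ1.le ?_
        have := le_max_left l n
        have := le_max_right l n
        omega
    _ = (∑ l ∈ Finset.range T, θ ^ l) * ∑ n ∈ Finset.range T, θ ^ n := by rw [Finset.sum_mul_sum]
    _ ≤ _ := mul_le_mul (sum_geometric_range_le hθ0 hθ1 T) (sum_geometric_range_le hθ0 hθ1 T)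
        (Finset.sum_nonneg fun n _ => pow_nonneg hθ0 n) (inv_nonneg.2 (by linarith))

/-- Chebyshev's inequality for the total number of observations which are needed to push the
running averages of the alternatives in `s` below `a`. -/
lemma measureReal_sum_stayCount_le {Ω ι : Type*} [MeasurableSpace Ω] {P : Measure Ω}
    [IsProbabilityMeasure P] {X : ι → ℕ → Ω → ℝ} {μ : ι → ℝ} {σ : ι → ℝ≥0}
    (hX : NormalObservations P X μ σ) {s : Finset ι} (hs : s.Nonempty) (a : ℝ) {δ τ V ε : ℝ}
    (hδ : 0 < δ) (hτ : 0 < τ) (hε : 0 < ε) (hμ : ∀ i ∈ s, μ i - a ≤ -δ)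
    (hσ : ∀ i ∈ s, (σ i : ℝ) ≤ τ)
    (hV : ∀ (d : ℝ) (σ : ℝ≥0) (T : ℕ), d ≤ -δ → (σ : ℝ) ≤ τ →
      ∫ y, stayCount T y ^ 2 ∂iidLaw (gaussianReal d (σ ^ 2)) ≤ V) (T : ℕ) :
    P.real {ω | s.card * (C (δ / τ) + ε) ≤ ∑ i ∈ s, stayCount T fun j => X i j ω - a} ≤
      V / (ε ^ 2 * s.card) := by
  let Y : ι → Ω → ℝ := fun i ω => stayCount T fun j => X i j ω - a
  have hcard : (0 : ℝ) < s.card := by exact_mod_cast hs.card_pos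
  have hY : ∀ i, MemLp (Y i) 2 P := fun i => memLp_stayCount P T (hX.measurable_row_sub a i)
  have hmean : ∀ i ∈ s, P[Y i] ≤ C (δ / τ) := by
    intro i hi
    have h := integral_map (μ := P) (hX.measurable_row_sub a i).aemeasurable
      (measurable_stayCount T).aestronglyMeasurable
    rw [hX.map_row_sub, integral_stayCount] at h
    exact h.symm.trans_le (sum_iidLaw_gaussian_staysPositive_le hδ (hμ i hi) hτ (hσ i hi) T)
  have hvar : ∀ i ∈ s, Var[Y i; P] ≤ V := by
    intro i hi
    refine (variance_le_expectation_sq (hY i).aestronglyMeasurable).trans ?_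
    have h := integral_map (μ := P) (hX.measurable_row_sub a i).aemeasurable
      ((measurable_stayCount T).pow_const 2).aestronglyMeasurable
    rw [hX.map_row_sub] at h
    exact h.symm.trans_le (hV _ _ T (hμ i hi) (hσ i hi))
  have hind : iIndepFun Y P :=
    hX.iIndepFun_row.comp (fun _ (y : ℕ → ℝ) => stayCount T fun j => y j - a)
      fun _ => (measurable_stayCount T).comp (by fun_prop)
  have hvarsum : Var[∑ i ∈ s, Y i; P] ≤ s.card * V := by
    rw [IndepFun.variance_sum (fun i _ => hY i) fun i _ j _ hij => hind.indepFun hij]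
    calc _ ≤ ∑ _i ∈ s, V := Finset.sum_le_sum hvar
      _ = _ := by simp
  have hmeansum : P[∑ i ∈ s, Y i] ≤ s.card * C (δ / τ) := by
    have : P[∑ i ∈ s, Y i] = ∑ i ∈ s, P[Y i] := by
      simp only [Finset.sum_apply]
      exact integral_finsetSum _ fun i _ => (hY i).integrable (by norm_num)
    rw [this]
    calc _ ≤ ∑ _i ∈ s, C (δ / τ) := Finset.sum_le_sum hmean
      _ = _ := by simp
  have hcheb := meas_ge_le_variance_div_sq (memLp_finsetSum' s fun i _ => hY i)
    (mul_pos hε hcard)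
  have hsub : {ω | s.card * (C (δ / τ) + ε) ≤ ∑ i ∈ s, stayCount T fun j => X i j ω - a} ⊆
      {ω | ε * s.card ≤ |(∑ i ∈ s, Y i) ω - P[∑ i ∈ s, Y i]|} := by
    intro ω hω
    refine le_trans ?_ (le_abs_self ((∑ i ∈ s, Y i) ω - P[∑ i ∈ s, Y i]))
    have hω' : s.card * (C (δ / τ) + ε) ≤ (∑ i ∈ s, Y i) ω := by
      rw [Finset.sum_apply]; exact hω
    linarith
  refine ENNReal.toReal_le_of_le_ofReal ?_ (((measure_mono hsub).trans hcheb).trans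
    (ENNReal.ofReal_le_ofReal ?_))
  · have : 0 ≤ V := (integral_nonneg fun y => sq_nonneg _).trans 
      (hV (-δ) 0 0 le_rfl (by simpa using hτ.le))
    positivity
  · calc _ ≤ s.card * V / (ε * s.card) ^ 2 :=
          div_le_div_of_nonneg_right hvarsum (sq_nonneg _)
      _ = _ := by field_simp

/-! ### Running averages of a Gaussian sequence -/

lemma measurable_runningAverage (n : ℕ) : Measurable fun y : ℕ → ℝ => runningAverage y n := by
  unfold runningAverage; fun_prop

/-- The sequences all of whose running averages exceed `a`. -/
def staysAbove (a : ℝ) : Set (ℕ → ℝ) := {y | ∀ n, 1 ≤ n → a < runningAverage y n}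

lemma measurableSet_staysAbove (a : ℝ) : MeasurableSet (staysAbove a) := by
  simp only [staysAbove, Set.ofPred_forall]
  exact .iInter fun n => .iInter fun _ =>
    measurableSet_lt measurable_const (measurable_runningAverage n)

lemma iidLaw_staysAbove (m : ℝ) {g : ℝ} (hg : 0 < g) {σ : ℝ≥0} (hσ : σ ≠ 0) :
    (iidLaw (gaussianReal m (σ ^ 2))).real (staysAbove (m - g)) = (C (g / σ))⁻¹ := by
  rw [← iidLaw_gaussian_forall_pos hg hσ]
  have h := map_sub_const_iidLaw m (m - g) (σ ^ 2)
  rw [sub_sub_cancel] at h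
  have hm : MeasurableSet {x : ℕ → ℝ | ∀ n, 1 ≤ n → 0 < partialSum x n} := by
    simp only [Set.ofPred_forall]
    exact .iInter fun n => .iInter fun _ =>
      measurableSet_lt measurable_const (measurable_partialSum n)
  rw [← h, map_measureReal_apply (by fun_prop) hm]
  congr 1
  ext y
  exact forall_congr' fun n => imp_congr_right fun hn =>
    (partialSum_sub_const_pos_iff y (m - g) hn).symm

lemma runningAverage_const (m : ℝ) {n : ℕ} (hn : 1 ≤ n) : runningAverage (fun _ => m) n = m := by
  have : (n : ℝ) ≠ 0 := by positivity
  simp [runningAverage, this]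

lemma iidLaw_gaussian_zero_var (m : ℝ) :
    iidLaw (gaussianReal m (0 ^ 2)) = Measure.dirac fun _ => m := by
  simp only [iidLaw, zero_pow two_ne_zero, gaussianReal_zero_var]
  exact Measure.infinitePi_dirac fun _ => m

lemma iidLaw_staysAbove_eq_ite (m : ℝ) {g : ℝ} (hg : 0 < g) (σ : ℝ≥0) :
    (iidLaw (gaussianReal m (σ ^ 2))).real (staysAbove (m - g)) =
      if σ = 0 then 1 else (C (g / σ))⁻¹ := by
  split_ifs with hσ
  · subst hσ
    rw [iidLaw_gaussian_zero_var, Measure.real,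
      Measure.dirac_apply' _ (measurableSet_staysAbove _), Set.indicator_of_mem]
    · simp
    · intro n hn
      rw [runningAverage_const m hn]
      linarith
  · exact iidLaw_staysAbove m hg hσ

/-- Never falling below `m` implies staying above `m - x σ` for each `x > 0`, which has probability
`1 / C x`; `C` is unbounded near `0`. -/
lemma ae_exists_runningAverage_lt (m : ℝ) {σ : ℝ≥0} (hσ : σ ≠ 0) :
    ∀ᵐ y ∂iidLaw (gaussianReal m (σ ^ 2)), ∃ n, 1 ≤ n ∧ runningAverage y n < m := by
  have hσ' : (0 : ℝ) < σ := by positivity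
  rw [ae_iff]
  set A := {y : ℕ → ℝ | ¬∃ n, 1 ≤ n ∧ runningAverage y n < m} with hA
  rw [← measureReal_eq_zero_iff]
  by_contra hne
  have hpos : 0 < (iidLaw (gaussianReal m (σ ^ 2))).real A :=
    lt_of_le_of_ne measureReal_nonneg (Ne.symm hne)
  obtain ⟨x, hx, hxC⟩ := exists_lt_C ((iidLaw (gaussianReal m (σ ^ 2))).real A)⁻¹ hσ'
  have h1 : (iidLaw (gaussianReal m (σ ^ 2))).real A ≤
      (iidLaw (gaussianReal m (σ ^ 2))).real (staysAbove (m - x * σ)) := by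
    refine measureReal_mono fun y hy n hn => ?_
    have : m ≤ runningAverage y n := by
      by_contra hlt
      exact hy ⟨n, hn, not_le.1 hlt⟩
    have := mul_pos hx.1 hσ'
    linarith
  rw [iidLaw_staysAbove m (mul_pos hx.1 hσ') hσ, mul_div_cancel_right₀ _ hσ'.ne'] at h1
  have h2 := inv_lt_of_inv_lt₀ hpos hxC
  linarith

lemma ae_tendsto_runningAverage (m : ℝ) (v : ℝ≥0) :
    ∀ᵐ y ∂iidLaw (gaussianReal m v), Tendsto (runningAverage y) atTop (𝓝 m) := by
  have hmap : ∀ i : ℕ, (iidLaw (gaussianReal m v)).map (fun y => y i) = gaussianReal m v :=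
    fun i => Measure.infinitePi_map_eval (fun _ : ℕ => gaussianReal m v) i
  have hind : iIndepFun (fun (i : ℕ) (x : ℕ → ℝ) => x i) (iidLaw (gaussianReal m v)) :=
    iIndepFun_infinitePi (P := fun _ : ℕ => gaussianReal m v) (X := fun _ x => x)
      fun _ => measurable_id
  have hint : Integrable (fun x : ℕ → ℝ => x 0) (iidLaw (gaussianReal m v)) := by
    have : Integrable id (gaussianReal m v) :=
      memLp_one_iff_integrable.1 (memLp_id_gaussianReal 1)
    rw [← hmap 0] at this
    exact this.comp_measurable (measurable_pi_apply 0)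
  have h := strong_law_ae_real (μ := iidLaw (gaussianReal m v)) (fun i x => x i) hint
    (fun i j hij => hind.indepFun hij) fun i =>
      ⟨(measurable_pi_apply i).aemeasurable, (measurable_pi_apply 0).aemeasurable,
        by rw [hmap, hmap]⟩
  have hmean : ∫ x : ℕ → ℝ, x 0 ∂iidLaw (gaussianReal m v) = m := by
    have h := integral_map (μ := iidLaw (gaussianReal m v)) (φ := fun x => x 0) (f := id)
      (measurable_pi_apply 0).aemeasurable measurable_id.aestronglyMeasurable
    rw [hmap 0] at h
    exact h.symm.trans integral_id_gaussianReal
  rw [hmean] at h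
  exact h

/-- The averages eventually exceed the value at `n₀`, so a last minimizer over an initial segment is
the last minimizer overall. -/
lemma exists_settlesAt {y : ℕ → ℝ} {m : ℝ} (hy : Tendsto (runningAverage y) atTop (𝓝 m)) {n₀ : ℕ}
    (hn₀ : 1 ≤ n₀) (hlt : runningAverage y n₀ < m) : ∃ N, 1 ≤ N ∧ SettlesAt y N := by
  obtain ⟨M, hM⟩ := eventually_atTop.1 (hy.eventually_const_lt hlt)
  obtain ⟨k, hk, hmin, hlast⟩ := exists_last_min (runningAverage y)
    (Finset.Icc 1 (max M n₀)) ⟨1, by simp; omega⟩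
  refine ⟨k, (Finset.mem_Icc.1 hk).1, Or.inl fun n hn => ?_⟩
  by_cases h : n ≤ max M n₀
  · exact hlast n (Finset.mem_Icc.2 ⟨by omega, h⟩) hn
  · have h1 := hmin n₀ (Finset.mem_Icc.2 ⟨hn₀, le_max_right _ _⟩)
    have h2 := hM n (by have := le_max_left M n₀; omega)
    linarith

lemma ae_exists_settlesAt (m : ℝ) (σ : ℝ≥0) :
    ∀ᵐ y ∂iidLaw (gaussianReal m (σ ^ 2)), ∃ N, 1 ≤ N ∧ SettlesAt y N := by
  rcases eq_or_ne σ 0 with rfl | hσ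
  · rw [iidLaw_gaussian_zero_var, ae_dirac_eq]
    exact ⟨1, le_rfl, Or.inr fun n hn => by
      rw [runningAverage_const m hn, runningAverage_const m le_rfl]⟩
  · filter_upwards [ae_exists_runningAverage_lt m hσ, ae_tendsto_runningAverage m (σ ^ 2)]
      with y ⟨n, hn, hlt⟩ hy
    exact exists_settlesAt hy hn hlt

lemma SettlesAt.exists_isLeast {y : ℕ → ℝ} {N : ℕ} (hN : 1 ≤ N) (h : SettlesAt y N) :
    ∃ n, 1 ≤ n ∧ ∀ k, 1 ≤ k → runningAverage y n ≤ runningAverage y k := by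
  rcases h with h | h
  · obtain ⟨n, hn, hmin⟩ := (Finset.Icc 1 N).exists_min_image (runningAverage y)
      ⟨1, by simp [hN]⟩
    refine ⟨n, (Finset.mem_Icc.1 hn).1, fun k hk => ?_⟩
    by_cases hkN : k ≤ N
    · exact hmin k (Finset.mem_Icc.2 ⟨hk, hkN⟩)
    · exact (hmin N (Finset.mem_Icc.2 ⟨hN, le_rfl⟩)).trans (h k (by omega)).le
  · exact ⟨1, le_rfl, fun k hk => (h k hk).ge⟩

lemma SettlesAt.exists_isLeast_iff {y : ℕ → ℝ} {N : ℕ} (hN : 1 ≤ N) (h : SettlesAt y N) (a : ℝ) :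
    (∃ z, IsLeast {z | ∃ n : ℕ, 1 ≤ n ∧ z = runningAverage y n} z ∧ a < z) ↔
      y ∈ staysAbove a := by
  constructor
  · rintro ⟨z, hz, haz⟩ n hn
    exact haz.trans_le (hz.2 ⟨n, hn, rfl⟩)
  · intro hy
    obtain ⟨n, hn, hmin⟩ := h.exists_isLeast hN
    exact ⟨runningAverage y n, ⟨⟨n, hn, rfl⟩, by rintro _ ⟨k, hk, rfl⟩; exact hmin k hk⟩, hy n hn⟩

lemma probMinAbove_eq {Ω ι : Type*} [MeasurableSpace Ω] {P : Measure Ω}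
    {X : ι → ℕ → Ω → ℝ} {μ : ι → ℝ} {σ : ι → ℝ≥0} (hX : NormalObservations P X μ σ) (i : ι)
    (a : ℝ) :
    probMinAbove P (X i) a = (iidLaw (gaussianReal (μ i) (σ i ^ 2))).real (staysAbove a) := by
  rw [← hX.map_row i, map_measureReal_apply (hX.measurable_row i) (measurableSet_staysAbove a)]
  refine measureReal_congr ?_
  have h := ae_exists_settlesAt (μ i) (σ i)
  rw [← hX.map_row i] at h
  filter_upwards [ae_of_ae_map (hX.measurable_row i).aemeasurable h] with ω ⟨N, hN, hset⟩
  exact propext (hset.exists_isLeast_iff hN a)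

/-- The sequences whose running averages exceed `a` and settle within `K` terms. -/
def settlesAbove (a : ℝ) (K : ℕ) : Set (ℕ → ℝ) :=
  {y | y ∈ staysAbove a ∧ ∃ N, 1 ≤ N ∧ N ≤ K ∧ SettlesAt y N}

lemma measurableSet_settlesAbove (a : ℝ) (K : ℕ) : MeasurableSet (settlesAbove a K) := by
  have hset : ∀ N, MeasurableSet {y | SettlesAt y N} := by
    intro N
    simp only [SettlesAt, Set.ofPred_or, Set.ofPred_forall]
    exact (MeasurableSet.iInter fun n => .iInter fun _ =>
      measurableSet_lt (measurable_runningAverage N) (measurable_runningAverage n)).union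
      (.iInter fun n => .iInter fun _ =>
        measurableSet_eq_fun (measurable_runningAverage n) (measurable_runningAverage 1))
  simp only [settlesAbove, Set.ofPred_and, Set.ofPred_exists]
  exact (measurableSet_staysAbove a).inter <| .iUnion fun N =>
    (MeasurableSet.const _).inter ((MeasurableSet.const _).inter (hset N))

/-- Almost every sequence settles at some finite time; continuity from below then removes the bound
`K`. -/
lemma tendsto_iidLaw_settlesAbove (m a : ℝ) (σ : ℝ≥0) :
    Tendsto (fun K => (iidLaw (gaussianReal m (σ ^ 2))).real (settlesAbove a K)) atTop
      (𝓝 ((iidLaw (gaussianReal m (σ ^ 2))).real (staysAbove a))) := by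
  have hmono : Monotone (settlesAbove a) := fun K K' hK y ⟨h1, N, h2, h3, h4⟩ =>
    ⟨h1, N, h2, h3.trans hK, h4⟩
  have h := tendsto_measure_iUnion_atTop (μ := iidLaw (gaussianReal m (σ ^ 2))) hmono
  have heq : (⋃ K, settlesAbove a K) =ᵐ[iidLaw (gaussianReal m (σ ^ 2))] staysAbove a := by
    filter_upwards [ae_exists_settlesAt m σ] with y ⟨N, hN, hset⟩
    refine propext ⟨fun hy => ?_, fun hy => ?_⟩
    · obtain ⟨K, hK⟩ := Set.mem_iUnion.1 hy
      exact hK.1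
    · exact Set.mem_iUnion.2 ⟨N, hy, N, hN, le_rfl, hset⟩
  rw [measure_congr heq] at h
  exact (ENNReal.tendsto_toReal (measure_ne_top _ _)).comp h

/-! ### The probability of correct selection -/

lemma one_le_C (x : ℝ) : 1 ≤ C x :=
  Real.one_le_exp (tsum_nonneg (C_term_nonneg x))

section PCS

variable {Ω : Type*} [MeasurableSpace Ω] {P : Measure Ω} [IsProbabilityMeasure P]

lemma PCS_le_one {m : ℕ} (r : ArgmaxRule (Fin (m + 1))) (X : Fin (m + 1) → ℕ → Ω → ℝ) (B : ℕ) :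
    PCS P r X B ≤ 1 := measureReal_le_one

/-- A lower bound on the probability of correct selection for a given number of alternatives. -/
lemma le_PCS {m : ℕ} (hm : 1 ≤ m) (r : ArgmaxRule (Fin (m + 1))) {X : Fin (m + 1) → ℕ → Ω → ℝ}
    {μ : Fin (m + 1) → ℝ} {σ : Fin (m + 1) → ℝ≥0} (hX : NormalObservations P X μ σ) {a δ τ V ε : ℝ}
    (hδ : 0 < δ) (hτ : 0 < τ) (hε : 0 < ε) (hμ : ∀ i, i ≠ 0 → μ i - a ≤ -δ)
    (hσ : ∀ i, (σ i : ℝ) ≤ τ)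
    (hV : ∀ (d : ℝ) (σ : ℝ≥0) (T : ℕ), d ≤ -δ → (σ : ℝ) ≤ τ →
      ∫ y, stayCount T y ^ 2 ∂iidLaw (gaussianReal d (σ ^ 2)) ≤ V) {B K : ℕ} (hB : m + 1 ≤ B)
    (hBK : m * (C (δ / τ) + ε) + K ≤ B) :
    (iidLaw (gaussianReal (μ 0) (σ 0 ^ 2))).real (settlesAbove a K) - V / (ε ^ 2 * m) ≤
      PCS P r X B := by
  have hcard : (Finset.univ.erase (0 : Fin (m + 1))).card = m := by simp
  have hcheb := measureReal_sum_stayCount_le hX (s := Finset.univ.erase 0)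
    (Finset.card_pos.1 (by rw [hcard]; exact hm)) a hδ hτ hε
    (fun i hi => hμ i (Finset.ne_of_mem_erase hi)) (fun i _ => hσ i) hV B
  rw [hcard] at hcheb
  rw [← hX.map_row 0, map_measureReal_apply (hX.measurable_row 0) (measurableSet_settlesAbove a K),
    sub_le_iff_le_add]
  refine le_trans (measureReal_mono ?_) ((measureReal_union_le _ _).trans
    (add_le_add le_rfl hcheb))
  intro ω hω
  rw [Set.mem_union, or_iff_not_imp_right]
  intro hbad
  refine greedySelect_eq (a := a) (K := K) hω.1 hω.2 (by simpa using hB) ?_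
  rw [Set.mem_ofPred_eq, not_le] at hbad
  linarith

end PCS

lemma le_liminf_of_tendsto_of_le {u v : ℕ → ℝ} {l b : ℝ} (hu : Tendsto u atTop (𝓝 l))
    (huv : ∀ᶠ n in atTop, u n ≤ v n) (hv : ∀ n, v n ≤ b) : l ≤ liminf v atTop := by
  rw [← hu.liminf_eq]
  exact liminf_le_liminf huv hu.isBoundedUnder_ge
    (isBoundedUnder_of ⟨b, hv⟩ : IsBoundedUnder (· ≤ ·) atTop v).isCoboundedUnder_ge

section Sequence

variable {Ω : Type*} [MeasurableSpace Ω] {P : Measure Ω} [IsProbabilityMeasure P]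
  {X : ∀ m : ℕ, Fin (m + 1) → ℕ → Ω → ℝ} {μ : ∀ m : ℕ, Fin (m + 1) → ℝ}
  {σ : ∀ m : ℕ, Fin (m + 1) → ℝ≥0} {μ₁ : ℝ} {σ₁ : ℝ≥0} {γ σbar : ℝ}

/-- The asymptotic lower bound at a level `μ₁ - g` for which the budget has some slack. -/
lemma staysAbove_le_liminf_PCS (hX : ∀ m, NormalObservations P (X m) (μ m) (σ m))
    (hμ₁ : ∀ m, μ m 0 = μ₁) (hσ₁ : ∀ m, σ m 0 = σ₁) (hσbar : 0 < σbar)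
    (hgap : ∀ m, ∀ i : Fin (m + 1), i ≠ 0 → γ ≤ μ₁ - μ m i)
    (hvar : ∀ m, ∀ i : Fin (m + 1), (σ m i : ℝ) ^ 2 ≤ σbar ^ 2)
    (r : ∀ m : ℕ, ArgmaxRule (Fin (m + 1))) {c g : ℝ} (hg : g < γ)
    (hc : C ((γ - g) / σbar) < c) {B : ℕ → ℕ} (hB : IsLinearBudget c B) :
    (iidLaw (gaussianReal μ₁ (σ₁ ^ 2))).real (staysAbove (μ₁ - g)) ≤
      liminf (fun m => PCS P (r m) (X m) (B m)) atTop := by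
  have hδ : 0 < γ - g := sub_pos.2 hg
  obtain ⟨V, hV⟩ := exists_integral_stayCount_sq_le hδ hσbar
  set c' := C ((γ - g) / σbar) with hc'
  have hc1 : 1 < c := (one_le_C _).trans_lt hc
  -- Half of the slack absorbs the Chebyshev fluctuation; the other half yields `ε m ≥ K`
  -- observations for the best alternative. Rounding is harmless because `c > 1` gives `B m > c m`.
  set ε := (c - c') / 2 with hε
  have hε0 : 0 < ε := by linarith
  refine le_of_tendsto' (tendsto_iidLaw_settlesAbove μ₁ (μ₁ - g) σ₁) fun K => ?_
  have hlim : Tendsto (fun m : ℕ => (iidLaw (gaussianReal μ₁ (σ₁ ^ 2))).real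
      (settlesAbove (μ₁ - g) K) - V / (ε ^ 2 * m)) atTop
      (𝓝 ((iidLaw (gaussianReal μ₁ (σ₁ ^ 2))).real (settlesAbove (μ₁ - g) K))) := by
    have h1 : Tendsto (fun m : ℕ => V / (ε ^ 2 * m)) atTop (𝓝 0) :=
      tendsto_const_nhds.div_atTop
        (tendsto_natCast_atTop_atTop.const_mul_atTop (pow_pos hε0 2))
    simpa using tendsto_const_nhds.sub h1
  refine le_liminf_of_tendsto_of_le hlim ?_ fun m => PCS_le_one (P := P) (r m) (X m) (B m)
  filter_upwards [eventually_ge_atTop 1,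
    (tendsto_natCast_atTop_atTop (R := ℝ)).eventually_ge_atTop ((K : ℝ) / ε)] with m hm hmK
  have hBm := (abs_lt.1 (hB m)).1
  have hm0 : (0 : ℝ) ≤ m := Nat.cast_nonneg m
  have h := le_PCS (K := K) (B := B m) hm (r m) (hX m) (a := μ₁ - g) hδ hσbar hε0
    (fun i hi => by have := hgap m i hi; linarith)
    (fun i => (sq_le_sq₀ (NNReal.coe_nonneg _) hσbar.le).1 (hvar m i)) hV ?_ ?_
  · rwa [hμ₁, hσ₁] at h
  · have : (m : ℝ) < B m := by nlinarith
    exact_mod_cast this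
  · have hK := (div_le_iff₀ hε0).1 hmK
    have e : c = c' + 2 * ε := by linarith
    rw [← hc']
    nlinarith

/-- At `γ₀` itself the budget has no slack, so the bound is taken at `g < γ₀`, where strict
monotonicity of `C` provides some, and passed to the limit by continuity. For `σ₁ = 0` the bound is
`1` at every such `g`. -/
lemma staysAbove_le_liminf_PCS_of_eq (hX : ∀ m, NormalObservations P (X m) (μ m) (σ m))
    (hμ₁ : ∀ m, μ m 0 = μ₁) (hσ₁ : ∀ m, σ m 0 = σ₁) (hσbar : 0 < σbar)
    (hgap : ∀ m, ∀ i : Fin (m + 1), i ≠ 0 → γ ≤ μ₁ - μ m i)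
    (hvar : ∀ m, ∀ i : Fin (m + 1), (σ m i : ℝ) ^ 2 ≤ σbar ^ 2)
    (r : ∀ m : ℕ, ArgmaxRule (Fin (m + 1))) {c γ₀ : ℝ} (hγ₀ : γ₀ ∈ Set.Ioo 0 γ)
    (hc : C ((γ - γ₀) / σbar) = c) {B : ℕ → ℕ} (hB : IsLinearBudget c B) :
    (if σ₁ = 0 then 1 else (C (γ₀ / σ₁))⁻¹) ≤
      liminf (fun m => PCS P (r m) (X m) (B m)) atTop := by
  have key : ∀ g ∈ Set.Ioo 0 γ₀, (if σ₁ = 0 then 1 else (C (g / σ₁))⁻¹) ≤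
      liminf (fun m => PCS P (r m) (X m) (B m)) atTop := by
    intro g hg
    rw [← iidLaw_staysAbove_eq_ite μ₁ hg.1 σ₁]
    refine staysAbove_le_liminf_PCS hX hμ₁ hσ₁ hσbar hgap hvar r (hg.2.trans hγ₀.2) ?_ hB
    rw [← hc]
    exact C_strictAntiOn (div_pos (by linarith [hγ₀.2]) hσbar)
      (div_pos (by linarith [hγ₀.2, hg.2]) hσbar)
      (div_lt_div_of_pos_right (by linarith [hg.2]) hσbar)
  split_ifs at key ⊢ with hσ
  · exact key (γ₀ / 2) ⟨half_pos hγ₀.1, half_lt_self hγ₀.1⟩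
  · have hσ' : (0 : ℝ) < σ₁ := by positivity
    have hcont : Tendsto (fun g : ℝ => (C (g / σ₁))⁻¹) (𝓝[<] γ₀) (𝓝 (C (γ₀ / σ₁))⁻¹) := by
      have h1 : ContinuousAt C (γ₀ / σ₁) :=
        continuousOn_C.continuousAt (Ioi_mem_nhds (div_pos hγ₀.1 hσ'))
      have h2 : ContinuousAt (fun g : ℝ => C (g / σ₁)) γ₀ :=
        ContinuousAt.comp' h1 (by fun_prop)
      exact (h2.inv₀ (C_pos _).ne').tendsto.mono_left nhdsWithin_le_nhds
    refine le_of_tendsto hcont ?_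
    filter_upwards [Ioo_mem_nhdsLT hγ₀.1] with g hg using key g hg

end Sequence
end GreedyRS

end

theorem theorem1 {Ω : Type*} [MeasurableSpace Ω] (P : Measure Ω) [IsProbabilityMeasure P]
    (X : ∀ m : ℕ, Fin (m + 1) → ℕ → Ω → ℝ)
    (μ : ∀ m : ℕ, Fin (m + 1) → ℝ) (σ : ∀ m : ℕ, Fin (m + 1) → ℝ≥0)
    (hX : ∀ m, GreedyRS.NormalObservations P (X m) (μ m) (σ m))
    (μ₁ : ℝ) (σ₁ : ℝ≥0) (hμ₁ : ∀ m, μ m 0 = μ₁) (hσ₁ : ∀ m, σ m 0 = σ₁)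
    (γ σbar : ℝ) (hγ : 0 < γ) (hσbar : 0 < σbar)
    (hgap : ∀ m, ∀ i : Fin (m + 1), i ≠ 0 → γ ≤ μ₁ - μ m i)
    (hvar : ∀ m, ∀ i : Fin (m + 1), (σ m i : ℝ) ^ 2 ≤ σbar ^ 2)
    (r : ∀ m : ℕ, GreedyRS.ArgmaxRule (Fin (m + 1))) :
    (∀ c : ℝ, GreedyRS.C (γ / σbar) < c →
      (∃! γ₀ : ℝ, γ₀ ∈ Set.Ioo 0 γ ∧ GreedyRS.C ((γ - γ₀) / σbar) = c) ∧
      ∀ γ₀ ∈ Set.Ioo 0 γ, GreedyRS.C ((γ - γ₀) / σbar) = c →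
        (∀ m₀, ∀ B : ℕ → ℕ, GreedyRS.IsLinearBudget c B →
          GreedyRS.probMinAbove P (X m₀ 0) (μ₁ - γ₀) ≤
            liminf (fun m => GreedyRS.PCS P (r m) (X m) (B m)) atTop) ∧
        (∀ m₀, GreedyRS.probMinAbove P (X m₀ 0) (μ₁ - γ₀) =
          if σ₁ = 0 then 1 else (GreedyRS.C (γ₀ / σ₁))⁻¹) ∧
        (∀ m₀, 0 < GreedyRS.probMinAbove P (X m₀ 0) (μ₁ - γ₀))) ∧
    GreedyRS.SampleOptimal (fun m b => GreedyRS.PCS P (r m) (X m) b) := by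
  have hprob : ∀ γ₀ : ℝ, 0 < γ₀ → ∀ m₀, GreedyRS.probMinAbove P (X m₀ 0) (μ₁ - γ₀) =
      if σ₁ = 0 then 1 else (GreedyRS.C (γ₀ / σ₁))⁻¹ := by
    intro γ₀ hγ₀ m₀
    rw [GreedyRS.probMinAbove_eq (hX m₀) 0, hμ₁, hσ₁, GreedyRS.iidLaw_staysAbove_eq_ite _ hγ₀]
  have hpos : ∀ γ₀ : ℝ, 0 < γ₀ → ∀ m₀, 0 < GreedyRS.probMinAbove P (X m₀ 0) (μ₁ - γ₀) := by
    intro γ₀ hγ₀ m₀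
    rw [hprob γ₀ hγ₀]
    split_ifs
    exacts [one_pos, inv_pos.2 (GreedyRS.C_pos _)]
  have hlim : ∀ c γ₀ : ℝ, γ₀ ∈ Set.Ioo 0 γ → GreedyRS.C ((γ - γ₀) / σbar) = c →
      ∀ m₀, ∀ B : ℕ → ℕ, GreedyRS.IsLinearBudget c B →
        GreedyRS.probMinAbove P (X m₀ 0) (μ₁ - γ₀) ≤
          liminf (fun m => GreedyRS.PCS P (r m) (X m) (B m)) atTop := by
    intro c γ₀ hγ₀ hc m₀ B hB
    rw [hprob γ₀ hγ₀.1]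
    exact GreedyRS.staysAbove_le_liminf_PCS_of_eq hX hμ₁ hσ₁ hσbar hgap hvar r hγ₀ hc hB
  refine ⟨fun c hc => ⟨GreedyRS.existsUnique_gap hγ hσbar hc, fun γ₀ hγ₀ hγ₀c =>
    ⟨hlim c γ₀ hγ₀ hγ₀c, hprob γ₀ hγ₀.1, hpos γ₀ hγ₀.1⟩⟩, ?_⟩
  obtain ⟨γ₀, ⟨hγ₀, hγ₀c⟩, -⟩ :=
    GreedyRS.existsUnique_gap hγ hσbar (lt_add_one (GreedyRS.C (γ / σbar)))
  -- Any budget factor above `C (γ / σbar)` would do. The positive lower bound comes from the best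
  -- alternative alone, whose law is the same for all `m`, so index `0` serves.
  exact ⟨GreedyRS.C (γ / σbar) + 1, add_pos (GreedyRS.C_pos _) one_pos, fun B hB =>
    (hpos γ₀ hγ₀.1 0).trans_le (hlim _ γ₀ hγ₀ hγ₀c 0 B hB)⟩
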